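/- **Model.** A ring has node set $\mathbb Z/n$, with $x$ joined to $x\pm1$; nodes and edges carry no labels visible to the robots. $k$ anonymous, oblivious, silent robots without sense of direction occupy distinct nodes. A *photo* is the set of occupied nodes up to rotations and reflections of the ring; $(r_{i_1},f_{j_1},r_{i_2},f_{j_2},\dots)$ denotes the photo in which one meets, going around the ring, $i_1$ occupied nodes, then $j_1$ free nodes, then $i_2$ occupied nodes, etc. A (deterministic) *algorithm* is a set of transitions $S\to S'$ between photos, with at most one transition for each $S$. A robot that observes the photo $S$ may decide to move to an adjacent node if this single move yields the photo $S'$; if several (robot, node) pairs qualify, the adversary chooses. Robots are fully asynchronous: observing (and computing) and moving are separate events, so a move may rely on an outdated photo. A robot is *activable* if it has a decided move still to carry out, or if it is idle and would decide to move. At each step the adversary selects an arbitrary nonempty set of activable robots, and each of them simultaneously either observes and decides (if idle) or carries out its decided move; if no robot is activable, nothing changes. Initially all robots are idle. A *collision* occurs when two robots are on the same node or cross each other on an edge. **Theorem.** Let $k=n-5$ with $k$ odd, $k>3$, and $n$ not a multiple of $k$. There is an algorithm for $k$ robots on the ring with $n$ nodes with the following properties. 1. (Permanent regime.) It contains the cycle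 of transitions $$(r_2,f_2,r_{n-7},f_3)\to(r_2,f_2,r_{n-8},f_1,r_1,f_2)\to(r_2,f_2,r_{n-8},f_2,r_1,f_1)\to(r_3,f_2,r_{n-8},f_3)\to(r_2,f_1,r_1,f_1,r_{n-8},f_3)\to(r_2,f_2,r_{n-7},f_3).$$ 2. (Perpetual exploration.) If $\gcd(n,k)=1$, then from every initial configuration (that is, any placement of the $k$ robots on distinct nodes), and whatever the adversary does, no collision ever occurs, every robot visits every node infinitely often, and from some time on the photo of the configuration is always one of the five photos in 1. If $\gcd(n,k)\neq1$ (that is, $5\mid k$), the same holds from every initial configuration whose set of occupied nodes is not invariant under a nontrivial rotation of the ring. -/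

import Mathlib

open Filter

namespace RingRobots

/-- The occupied nodes of a ring with `n` nodes. The nodes are the elements of `ZMod n` and `x` is
joined to `x + 1` and `x - 1`; this labelling is invisible to the robots. -/
abbrev Config (n : ℕ) : Type := Set (ZMod n)

/-- Two sets of occupied nodes look the same, up to a rotation or a reflection of the ring. -/
def SameUpToSymmetry {n : ℕ} (C D : Config n) : Prop :=
  ∃ a e : ZMod n, (e = 1 ∨ e = -1) ∧ ∀ x, x ∈ D ↔ a + e * x ∈ C

/-- Looking the same is an equivalence relation. -/
instance photoSetoid (n : ℕ) : Setoid (Config n) where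
  r := SameUpToSymmetry
  iseqv := by
    refine ⟨fun C => ⟨0, 1, Or.inl rfl, fun x => by simp⟩, ?_, ?_⟩
    · rintro C D ⟨a, e, he, h⟩
      refine ⟨-(e * a), e, he, fun x => ?_⟩
      have hee : e * e = 1 := by rcases he with rfl | rfl <;> ring
      rw [h]
      have : a + e * (-(e * a) + e * x) = x := by linear_combination (x - a) * hee
      rw [this]
    · rintro C D F ⟨a, e, he, h⟩ ⟨b, f, hf, h'⟩
      refine ⟨a + e * b, e * f, ?_, fun x => ?_⟩
      · rcases he with rfl | rfl <;> rcases hf with rfl | rfl <;> simp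
      · rw [h', h]
        have : a + e * (b + f * x) = a + e * b + e * f * x := by ring
        rw [this]

/-- A photo (snapshot): an unoriented circular word of occupied and free nodes. -/
def Photo (n : ℕ) : Type := Quotient (photoSetoid n)

/-- The photo of a set of occupied nodes. -/
def photo {n : ℕ} (C : Config n) : Photo n := Quotient.mk (photoSetoid n) C

/-- The linear word `r_{i₁} f_{j₁} r_{i₂} f_{j₂} …` (`true`: a robot, `false`: a free node). -/
def blockWord (L : List (ℕ × ℕ)) : List Bool :=
  L.flatMap fun b => List.replicate b.1 true ++ List.replicate b.2 false

/-- The photo `(r_{i₁}, f_{j₁}, r_{i₂}, f_{j₂}, …)` of a ring with `n` nodes: going around the ring,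
`i₁` occupied nodes, then `j₁` free nodes, then `i₂` occupied nodes, and so on
(meaningful when the lengths add up to `n`). -/
def blocks (n : ℕ) (L : List (ℕ × ℕ)) : Photo n :=
  photo {x : ZMod n | (blockWord L)[x.val]? = some true}

/-- An algorithm is a set of transitions `S → S'` between photos, at most one for each `S`
(`none`: no robot has to move). A robot has no other input than the photo it takes, so robots are
anonymous, oblivious, silent and without any sense of direction. -/
abbrev Algorithm (n : ℕ) : Type := Photo n → Option (Photo n)

/-- The photo of `k` robots at the positions `pos`. -/
def photoAt {n k : ℕ} (pos : Fin k → ZMod n) : Photo n := photo (Set.range pos)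

/-- With the robots at `pos`, a robot `r` that observes and computes may decide to go to the
neighbouring node `y`: this single move produces the photo prescribed by the algorithm. When several
pairs `(r, y)` qualify, nothing distinguishes them for the robots, and the adversary
chooses. -/
def Algorithm.Decides {n k : ℕ} (A : Algorithm n) (pos : Fin k → ZMod n) (r : Fin k)
    (y : ZMod n) : Prop :=
  (y = pos r + 1 ∨ y = pos r - 1) ∧
    A (photoAt pos) = some (photoAt (Function.update pos r y))

/-- A global state of `k` asynchronous robots: their positions, and for every robot that has observed
and computed but not yet moved, the node it is going to move to. (The names `Fin k` of the robots
serve to express the specification only.) -/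
structure State (n k : ℕ) where
  pos : Fin k → ZMod n
  plan : Fin k → Option (ZMod n)

/-- The robot `r` is activable: it has a move to carry out, or it is idle and would decide
to move. -/
def State.Activable {n k : ℕ} (A : Algorithm n) (s : State n k) (r : Fin k) : Prop :=
  (∃ y, s.plan r = some y) ∨ (s.plan r = none ∧ ∃ y, A.Decides s.pos r y)

/-- The robot `r` acts between `s` and `s'`. Either it is idle, takes a photo of `s` and decides to go
to `y`; or it carries out the move that it decided on earlier, perhaps on an outdated photo. -/
def Acts {n k : ℕ} (A : Algorithm n) (s s' : State n k) (r : Fin k) : Prop :=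
  (s.plan r = none ∧ ∃ y, A.Decides s.pos r y ∧ s'.pos r = s.pos r ∧ s'.plan r = some y) ∨
    (∃ y, s.plan r = some y ∧ s'.pos r = y ∧ s'.plan r = none)

/-- One step: the adversary makes a nonempty set `T` of activable robots act simultaneously, the
others keep still; if no robot is activable then nothing changes. -/
def Step {n k : ℕ} (A : Algorithm n) (s s' : State n k) : Prop :=
  (∃ T : Set (Fin k), T.Nonempty ∧ (∀ r ∈ T, Acts A s s' r) ∧
      ∀ r, r ∉ T → s'.pos r = s.pos r ∧ s'.plan r = s.plan r) ∨
    ((∀ r, ¬ s.Activable A r) ∧ s' = s)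

/-- An execution of the algorithm from the initial positions `init`, all robots being idle. -/
structure IsExecution {n k : ℕ} (A : Algorithm n) (init : Fin k → ZMod n)
    (s : ℕ → State n k) : Prop where
  pos_zero : (s 0).pos = init
  plan_zero : ∀ r, (s 0).plan r = none
  step : ∀ t, Step A (s t) (s (t + 1))

/-- No collision: never two robots on one node, never two robots crossing on one edge. -/
def CollisionFree {n k : ℕ} (s : ℕ → State n k) : Prop :=
  ∀ t, ∀ r q : Fin k, r ≠ q → (s t).pos r ≠ (s t).pos q ∧
    ¬ ((s (t + 1)).pos r = (s t).pos q ∧ (s (t + 1)).pos q = (s t).pos r)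

/-- Every robot visits every node infinitely often. -/
def VisitsForever {n k : ℕ} (s : ℕ → State n k) : Prop :=
  ∀ (r : Fin k) (x : ZMod n), ∃ᶠ t in atTop, (s t).pos r = x

/-- No rotation of the ring except the identity preserves the set of occupied nodes. -/
def Aperiodic {n k : ℕ} (pos : Fin k → ZMod n) : Prop :=
  ∀ a : ZMod n, (∀ x, x ∈ Set.range pos ↔ x + a ∈ Set.range pos) → a = 0

/-- The cycle of photos of the permanent regime with `n - 5` robots. From a group of `2` and a group
of `n - 7` robots, with `2` free nodes between them on one side and `3` on the other, a robot of the
large group crosses the `3` free nodes and joins the small group; then the robot at the other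
end of the small group crosses the `2` free nodes and joins the large group. -/
def permanentPhoto (n : ℕ) : Fin 5 → Photo n :=
  ![blocks n [(2, 2), (n - 7, 3)],
    blocks n [(2, 2), (n - 8, 1), (1, 2)],
    blocks n [(2, 2), (n - 8, 2), (1, 1)],
    blocks n [(3, 2), (n - 8, 3)],
    blocks n [(2, 1), (1, 1), (n - 8, 3)]]

end RingRobots

/-! The five free nodes cut the robots into five gaps `(a, b, c, d, e)`, and a photo is such a
vector up to rotation and reflection. Put `m = k - 3`; the hypotheses force `m` to be even and at
least 4. Vectors with all gaps equal are excluded by coprimality or aperiodicity. As 5 is prime,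
every other vector has only the trivial rotational symmetry, so at most a reflection makes two
robots indistinguishable.

Asynchrony does harm only there: two mirror-image robots may both decide, and one may move while the
move of the other is still pending. The remedy is built into `Edge`. In a symmetric vector only a
`MirrorMove` is allowed, and whenever one move restores a symmetry, that `RestoreMove` is
compulsory. It is unique (`RestoreMove.unique`), so a pending mirror move is still what the
algorithm prescribes after its twin has moved (`Regular.decides_update`). Hence the invariant
`Valid`: each pending move could also be decided on now. Any step then amounts to a sequence of
up-to-date moves.

The combinatorial core is `Good.of_not_const`: every vector with unequal gaps leads to the permanent
cycle along allowed moves. An asymmetric vector feeds its largest gap. A symmetric one is worked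
down to a single robot on the axis, whose move breaks the symmetry for good (`Good.broken`); two
unequal blocks are then formed. The algorithm follows shortest paths, so the pair (distance, number
of idle robots) decreases lexicographically until the cycle is reached.

In the cycle one robot at a time moves, always in the same direction, and a round of five moves
shifts the free nodes by one. So every node becomes free again and again; each robot must keep
leaving its node, and it goes around the ring forever. -/

namespace RingRobots

/-! ### Gap vectors, allowed moves, and their uniqueness -/

/-- The numbers of robots between consecutive free nodes, going around a ring with five free nodes
from one of them. -/
structure Gaps where
  a : ℕ
  b : ℕ
  c : ℕ
  d : ℕ
  e : ℕ

namespace Gaps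

/-- The number of robots. -/
def sum (g : Gaps) : ℕ := g.a + g.b + g.c + g.d + g.e

/-- The gaps seen from each of the five free nodes, in each of the two directions. -/
def views (g : Gaps) : List Gaps :=
  [⟨g.a, g.b, g.c, g.d, g.e⟩, ⟨g.b, g.c, g.d, g.e, g.a⟩, ⟨g.c, g.d, g.e, g.a, g.b⟩,
    ⟨g.d, g.e, g.a, g.b, g.c⟩, ⟨g.e, g.a, g.b, g.c, g.d⟩, ⟨g.e, g.d, g.c, g.b, g.a⟩,
    ⟨g.d, g.c, g.b, g.a, g.e⟩, ⟨g.c, g.b, g.a, g.e, g.d⟩, ⟨g.b, g.a, g.e, g.d, g.c⟩,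
    ⟨g.a, g.e, g.d, g.c, g.b⟩]

/-- The same gaps up to rotation and reflection. -/
def Sim (g h : Gaps) : Prop := h ∈ g.views

/-- The effect of moving the first robot of the first gap into the free node behind it. -/
def mv (g : Gaps) : Gaps := ⟨g.a - 1, g.b, g.c, g.d, g.e + 1⟩

/-- No other move gives the same gaps up to symmetry. -/
def UniqueMove (g : Gaps) : Prop :=
  ∀ v, g.Sim v → 1 ≤ v.a → g.mv.Sim v.mv → v = g

/-- All gaps are equal. -/
def Const (g : Gaps) : Prop := g.a = g.b ∧ g.b = g.c ∧ g.c = g.d ∧ g.d = g.e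

/-- Invariance under a reflection. -/
def Mirror (g : Gaps) : Prop :=
  (g.b = g.e ∧ g.c = g.d) ∨ (g.c = g.a ∧ g.d = g.e) ∨ (g.d = g.b ∧ g.e = g.a) ∨
    (g.e = g.c ∧ g.a = g.b) ∨ (g.a = g.d ∧ g.b = g.c)

/-- The moves of the algorithm in symmetric configurations. -/
def MirrorMove (g : Gaps) : Prop :=
  (1 ≤ g.a ∧ g.b = g.e ∧ g.c = g.d ∧
      (g.a = 1 ∨ g.b = 0 ∨ g.c < g.b ∨ (g.c = g.b ∧ g.a < g.b))) ∨
    (g.c = g.a ∧ g.d = g.e ∧ 3 ≤ g.b ∧ 1 ≤ g.a ∧ g.a < g.e) ∨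
    (1 ≤ g.a ∧ g.b = g.a ∧ g.c = g.a ∧ g.e = g.a ∧ 3 ≤ g.d ∧ g.a < g.d)

/-- The moves of the algorithm that restore a symmetry. -/
def RestoreMove (g : Gaps) : Prop :=
  (2 ≤ g.a ∧ g.b = g.e + 1 ∧ g.c = g.d ∧
      (g.e = 0 ∨ g.c < g.e ∨ (g.c = g.e ∧ g.a + 1 < g.c))) ∨
    (g.a = g.c + 1 ∧ g.d = g.e + 1 ∧ 3 ≤ g.b ∧ g.a < g.e) ∨
    (1 ≤ g.a ∧ g.a = g.b + 1 ∧ g.c = g.a + 1 ∧ g.e = g.a ∧ 3 ≤ g.d ∧ g.a < g.d)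

/-- One move restores a symmetry. -/
def Restorable (g : Gaps) : Prop := ∃ v, g.Sim v ∧ v.RestoreMove

/-- The gaps of the permanent regime. -/
def perm (m : ℕ) : Fin 5 → Gaps :=
  ![⟨m + 1, 0, 2, 0, 0⟩, ⟨1, m, 0, 2, 0⟩, ⟨1, 0, m, 0, 2⟩, ⟨3, 0, 0, m, 0⟩, ⟨1, 2, 0, 0, m⟩]

/-- A move that the algorithm may make. -/
def Edge (g : Gaps) : Prop :=
  1 ≤ g.a ∧ g.UniqueMove ∧ (g.Mirror → g.MirrorMove) ∧ (g.Restorable → g.RestoreMove)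

set_option maxHeartbeats 1000000 in
-- The two mirror-image moves come from the same vector, so they do not count as different. All
-- other coincidences form a finite table of linear conditions.
theorem UniqueMove.of_mirrorMove {g : Gaps} (h : g.MirrorMove) (hs : g.sum % 2 = 1)
    (hs7 : 7 ≤ g.sum) (hc : ¬ g.Const) : g.UniqueMove := by
  obtain ⟨a, b, c, d, e⟩ := g
  rintro v hv ha hm
  simp only [Sim, views, List.mem_cons, List.not_mem_nil, or_false, mv, MirrorMove, sum,
    Const] at *
  rcases h with ⟨h1, rfl, rfl, h⟩ | ⟨rfl, rfl, h1, h2, h3⟩ | ⟨h1, rfl, rfl, rfl, h2, h3⟩ <;>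
  rcases hv with rfl | rfl | rfl | rfl | rfl | rfl | rfl | rfl | rfl | rfl <;>
  simp only [mk.injEq, true_and, and_true] at * <;>
  first
  | done
  | (rcases hm with hm | hm | hm | hm | hm | hm | hm | hm | hm | hm <;> omega)

theorem UniqueMove.of_restoreMove {g : Gaps} (h : g.RestoreMove) (hs : g.sum % 2 = 1)
    (hs7 : 7 ≤ g.sum) : g.UniqueMove := by
  obtain ⟨a, b, c, d, e⟩ := g
  rintro v hv ha hm
  simp only [Sim, views, List.mem_cons, List.not_mem_nil, or_false, mv, RestoreMove, sum] at *
  rcases hv with rfl | rfl | rfl | rfl | rfl | rfl | rfl | rfl | rfl | rfl <;>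
  simp only [mk.injEq] at * <;>
  rcases hm with hm | hm | hm | hm | hm | hm | hm | hm | hm | hm <;> omega

/-- The gap that receives the robot becomes the only maximum, which determines the move up to the
reflection fixing that gap. -/
theorem UniqueMove.of_le {g : Gaps} (h : g.a ≤ g.e ∧ g.b ≤ g.e ∧ g.c ≤ g.e ∧ g.d ≤ g.e)
    (hs : ¬ g.Mirror) : g.UniqueMove := by
  obtain ⟨a, b, c, d, e⟩ := g
  rintro v hv ha hm
  simp only [Sim, views, List.mem_cons, List.not_mem_nil, or_false, mv, Mirror] at *
  rcases hv with rfl | rfl | rfl | rfl | rfl | rfl | rfl | rfl | rfl | rfl <;>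
  simp only [mk.injEq] at * <;>
  rcases hm with hm | hm | hm | hm | hm | hm | hm | hm | hm | hm <;> omega

/-- Ensures that the two symmetry rules of `Edge` never compete. -/
theorem not_mirror_of_restorable {g : Gaps} (h : g.Restorable) (hs : g.sum % 2 = 1)
    (hs7 : 7 ≤ g.sum) : ¬ g.Mirror := by
  obtain ⟨v, hv, h⟩ := h
  obtain ⟨a, b, c, d, e⟩ := g
  simp only [Sim, views, List.mem_cons, List.not_mem_nil, or_false, RestoreMove, sum, Mirror] at *
  rcases hv with rfl | rfl | rfl | rfl | rfl | rfl | rfl | rfl | rfl | rfl <;>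
  simp only at * <;> omega

/-- A broken symmetry can be repaired in one way only, so the algorithm cannot prefer another repair
to the pending one. -/
theorem RestoreMove.unique {g v : Gaps} (h : g.RestoreMove) (hs : g.sum % 2 = 1)
    (hs7 : 7 ≤ g.sum) (hv : g.Sim v) (h' : v.RestoreMove) : v = g := by
  obtain ⟨a, b, c, d, e⟩ := g
  simp only [Sim, views, List.mem_cons, List.not_mem_nil, or_false, RestoreMove, sum] at *
  rcases hv with rfl | rfl | rfl | rfl | rfl | rfl | rfl | rfl | rfl | rfl <;>
  simp only [mk.injEq] at * <;> omega

end Gaps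
end RingRobots

/-! ### Equivalent views, the permanent cycle, and reachability -/

namespace RingRobots
namespace Gaps

theorem Sim.refl (g : Gaps) : g.Sim g := by simp [Sim, views]

theorem Sim.symm {g h : Gaps} (H : g.Sim h) : h.Sim g := by
  simp only [Sim, views, List.mem_cons, List.not_mem_nil, or_false] at H
  rcases H with rfl | rfl | rfl | rfl | rfl | rfl | rfl | rfl | rfl | rfl <;> simp [Sim, views]

theorem Sim.trans {g h l : Gaps} (H : g.Sim h) (H' : h.Sim l) : g.Sim l := by
  simp only [Sim, views, List.mem_cons, List.not_mem_nil, or_false] at H H'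
  rcases H with rfl | rfl | rfl | rfl | rfl | rfl | rfl | rfl | rfl | rfl <;>
  rcases H' with rfl | rfl | rfl | rfl | rfl | rfl | rfl | rfl | rfl | rfl <;>
  simp [Sim, views]

theorem Sim.sum_eq {g h : Gaps} (H : g.Sim h) : h.sum = g.sum := by
  simp only [Sim, views, List.mem_cons, List.not_mem_nil, or_false] at H
  rcases H with rfl | rfl | rfl | rfl | rfl | rfl | rfl | rfl | rfl | rfl <;>
  simp only [sum] <;> omega

theorem Sim.const {g h : Gaps} (H : g.Sim h) (hg : g.Const) : h.Const := by
  simp only [Sim, views, List.mem_cons, List.not_mem_nil, or_false] at H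
  simp only [Const] at *
  rcases H with rfl | rfl | rfl | rfl | rfl | rfl | rfl | rfl | rfl | rfl <;>
  simp only <;> omega

theorem sum_mv {g : Gaps} (h : 1 ≤ g.a) : g.mv.sum = g.sum := by
  simp only [mv, sum]; omega

theorem sum_perm (m : ℕ) (i : Fin 5) : (perm m i).sum = m + 3 := by
  fin_cases i <;> simp [perm, sum] <;> omega

theorem one_le_perm_a (m : ℕ) (i : Fin 5) : 1 ≤ (perm m i).a := by
  fin_cases i <;> simp [perm]

/-- Move to the next photo of the permanent regime, seen from the previous free node. -/
theorem mv_perm (m : ℕ) (i : Fin 5) :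
    (perm m i).mv = ⟨(perm m (i + 1)).b, (perm m (i + 1)).c, (perm m (i + 1)).d,
      (perm m (i + 1)).e, (perm m (i + 1)).a⟩ := by
  fin_cases i <;> simp [perm, mv]

theorem not_mirror_perm {m : ℕ} (hm : 4 ≤ m) (i : Fin 5) : ¬ (perm m i).Mirror := by
  fin_cases i <;> simp [perm, Mirror] <;> omega

theorem not_const_of_not_mirror {g : Gaps} (h : ¬ g.Mirror) : ¬ g.Const := by
  simp only [Mirror, Const] at *; omega

/-- With `not_mirror_perm`, this makes both symmetry rules of `Edge` vacuous on the cycle. -/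
theorem not_restorable_perm {m : ℕ} (hm : 4 ≤ m) (hm' : m % 2 = 0) (i : Fin 5) :
    ¬ (perm m i).Restorable := by
  rintro ⟨v, hv, h⟩
  fin_cases i <;> simp [perm, Sim, views, RestoreMove] at hv h <;>
  rcases hv with rfl | rfl | rfl | rfl | rfl | rfl | rfl | rfl | rfl | rfl <;> simp at h <;> omega

theorem perm_unique {m : ℕ} (hm : 4 ≤ m) {i j : Fin 5}
    (h : (perm m i).Sim (perm m j)) : i = j := by
  fin_cases i <;> fin_cases j <;> simp [perm, Sim, views] at h ⊢ <;> omega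

theorem uniqueMove_perm {m : ℕ} (hm : 4 ≤ m) (i : Fin 5) : (perm m i).UniqueMove := by
  intro v hv ha hs
  fin_cases i <;> simp [perm, Sim, views] at hv <;>
  rcases hv with rfl | rfl | rfl | rfl | rfl | rfl | rfl | rfl | rfl | rfl <;>
  simp [perm, mv, Sim, views] at ha hs ⊢ <;> omega

theorem edge_perm {m : ℕ} (hm : 4 ≤ m) (hm' : m % 2 = 0) (i : Fin 5) : (perm m i).Edge :=
  ⟨one_le_perm_a m i, uniqueMove_perm hm i, fun h => absurd h (not_mirror_perm hm i),
    fun h => absurd h (not_restorable_perm hm hm' i)⟩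

theorem MirrorMove.mirror {g : Gaps} (h : g.MirrorMove) : g.Mirror := by
  simp only [MirrorMove, Mirror] at *; omega

theorem MirrorMove.one_le {g : Gaps} (h : g.MirrorMove) : 1 ≤ g.a := by
  simp only [MirrorMove] at *; omega

theorem RestoreMove.one_le {g : Gaps} (h : g.RestoreMove) : 1 ≤ g.a := by
  simp only [RestoreMove] at *; omega

theorem MirrorMove.edge {g : Gaps} (h : g.MirrorMove) (hs : g.sum % 2 = 1)
    (hs7 : 7 ≤ g.sum) (hc : ¬ g.Const) : g.Edge :=
  ⟨h.one_le, .of_mirrorMove h hs hs7 hc, fun _ => h,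
    fun h' => absurd h.mirror (not_mirror_of_restorable h' hs hs7)⟩

theorem RestoreMove.edge {g : Gaps} (h : g.RestoreMove) (hs : g.sum % 2 = 1)
    (hs7 : 7 ≤ g.sum) : g.Edge :=
  ⟨h.one_le, .of_restoreMove h hs hs7,
    fun h' => absurd h' (not_mirror_of_restorable ⟨g, .refl g, h⟩ hs hs7), fun _ => h⟩

/-- The permanent regime can be reached in the given number of moves. -/
inductive Dist (m : ℕ) : Gaps → ℕ → Prop
  | perm {g : Gaps} (i : Fin 5) (h : g.Sim (perm m i)) : Dist m g 0
  | step {g v : Gaps} {t : ℕ} (h : g.Sim v) (he : v.Edge) (hd : Dist m v.mv t) : Dist m g (t + 1)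

/-- The permanent regime can be reached. -/
def Good (m : ℕ) (g : Gaps) : Prop := ∃ t, Dist m g t

theorem Good.step {m : ℕ} {g v : Gaps} (hd : Good m v.mv) (h : g.Sim v) (he : v.Edge) :
    Good m g :=
  let ⟨t, ht⟩ := hd
  ⟨t + 1, .step h he ht⟩

theorem Good.of_sim {m : ℕ} {g h : Gaps} (H : g.Sim h) (hg : Good m h) : Good m g := by
  obtain ⟨t, ht⟩ := hg
  cases ht with
  | perm i h' => exact ⟨0, .perm i (H.trans h')⟩
  | step h' he hd => exact ⟨_, .step (H.trans h') he hd⟩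

/-- A move from gaps that are neither symmetric nor one move away from a symmetry. -/
theorem Good.free {m : ℕ} {g : Gaps} (hd : Good m g.mv) (ha : 1 ≤ g.a) (hu : g.UniqueMove)
    (hm : ¬ g.Mirror) (hr : ¬ g.Restorable) : Good m g :=
  hd.step (.refl g) ⟨ha, hu, fun h => absurd h hm, fun h => absurd h hr⟩

/-- Two moves from symmetric gaps. -/
theorem Good.mirror {m : ℕ} {g h : Gaps} (hg : g.MirrorMove) (hs : g.sum % 2 = 1)
    (hs7 : 7 ≤ g.sum) (hc : ¬ g.Const) (hh : h.RestoreMove) (H : g.mv.Sim h)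
    (hd : Good m h.mv) : Good m g := by
  have hs' : h.sum = g.sum := by rw [H.sum_eq, sum_mv hg.one_le]
  exact (hd.step H (hh.edge (by omega) (by omega))).step (.refl g) (hg.edge hs hs7 hc)

end Gaps
end RingRobots

/-! ### Every vector with unequal gaps reaches the permanent cycle -/

namespace RingRobots
namespace Gaps

/-- Robots of the smaller block cross the two free nodes one by one and join the larger block, until
the smaller one has 2 or 3 robots, as in two photos of the cycle. -/
theorem Good.line {m : ℕ} (hm : 4 ≤ m) (hm' : m % 2 = 0) :
    ∀ d M : ℕ, 2 ≤ d → d < M → M + d = m + 3 → Good m ⟨M, 0, 0, d, 0⟩ := by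
  intro d
  induction d using Nat.strong_induction_on with
  | _ d ih =>
    intro M h2 hd hs
    by_cases h : d = 2
    · subst h
      refine ⟨0, .perm 0 ?_⟩
      obtain rfl : M = m + 1 := by omega
      simp [Sim, views, perm]
    by_cases h : d = 3
    · subst h
      refine ⟨0, .perm 3 ?_⟩
      obtain rfl : M = m := by omega
      simp [Sim, views, perm]
    -- The crossing robot is halfway, alone between the two free nodes.
    have h1 : Good m ⟨1, d - 1, 0, 0, M⟩ := by
      refine Good.free ?_ le_rfl ?_ ?_ ?_
      · refine (ih (d - 1) (by omega) (M + 1) (by omega) (by omega) (by omega)).of_sim ?_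
        simp [Sim, views, mv]
      · apply UniqueMove.of_le <;> simp [Mirror] <;> omega
      · simp [Mirror]; omega
      · rintro ⟨v, hv, h⟩
        simp [Sim, views, RestoreMove] at hv h
        rcases hv with rfl | rfl | rfl | rfl | rfl | rfl | rfl | rfl | rfl | rfl <;>
        simp at h <;> omega
    have h2 : Good m ⟨d, 0, 0, M, 0⟩ := by
      refine Good.free (h1.of_sim ?_) (by simp; omega) ?_ ?_ ?_
      · simp [Sim, views, mv]
      · intro v hv ha hs
        simp [Sim, views] at hv
        rcases hv with rfl | rfl | rfl | rfl | rfl | rfl | rfl | rfl | rfl | rfl <;>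
        simp [mv, Sim, views] at ha hs ⊢ <;> omega
      · simp [Mirror]; omega
      · rintro ⟨v, hv, h⟩
        simp [Sim, views, RestoreMove] at hv h
        rcases hv with rfl | rfl | rfl | rfl | rfl | rfl | rfl | rfl | rfl | rfl <;>
        simp at h
    exact h2.of_sim (by simp [Sim, views])

/-- The block `x` is emptied into its neighbour `y`, which leaves two blocks of sizes `x + y + 1`
and `x + y`. -/
theorem Good.merge {m : ℕ} (hm : 4 ≤ m) (hm' : m % 2 = 0) :
    ∀ x y M : ℕ, M = x + y + 1 → M + x + y = m + 3 → Good m ⟨x, M, 0, 0, y⟩ := by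
  intro x
  induction x with
  | zero =>
    intro y M h hs
    exact (Good.line hm hm' y M (by omega) (by omega) (by omega)).of_sim (by simp [Sim, views])
  | succ x ih =>
    intro y M h hs
    refine Good.free ?_ (by simp) ?_ ?_ ?_
    · exact (ih (y + 1) M (by omega) (by omega)).of_sim (by simp [mv, Sim.refl])
    · intro v hv ha hs
      simp [Sim, views] at hv
      rcases hv with rfl | rfl | rfl | rfl | rfl | rfl | rfl | rfl | rfl | rfl <;>
      simp [mv, Sim, views] at ha hs ⊢ <;> omega
    · simp [Mirror]; omega
    · rintro ⟨v, hv, h⟩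
      simp [Sim, views, RestoreMove] at hv h
      rcases hv with rfl | rfl | rfl | rfl | rfl | rfl | rfl | rfl | rfl | rfl <;>
      simp at h <;> omega

/-- The gap `p` is emptied into `q`, which becomes the large block of `Good.merge`; then `a` and `b`
are merged. -/
theorem Good.absorb {m : ℕ} (hm : 4 ≤ m) (hm' : m % 2 = 0) :
    ∀ p q a b : ℕ, 2 ≤ a → a ≤ q → p + q = a + b + 1 → p + q + a + b = m + 3 →
      Good m ⟨p, 0, b, a, q⟩ := by
  intro p
  induction p with
  | zero =>
    intro q a b h2 hq h hs
    exact (Good.merge hm hm' a b q (by omega) (by omega)).of_sim (by simp [Sim, views])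
  | succ p ih =>
    intro q a b h2 hq h hs
    refine Good.free ?_ (by simp) ?_ ?_ ?_
    · exact (ih (q + 1) a b h2 (by omega) (by omega) (by omega)).of_sim (by simp [mv, Sim.refl])
    · intro v hv ha hs
      simp only [Sim, views, List.mem_cons, List.not_mem_nil, or_false, mv] at *
      rcases hv with rfl | rfl | rfl | rfl | rfl | rfl | rfl | rfl | rfl | rfl <;>
      simp only [mk.injEq] at * <;>
      rcases hs with hm | hm | hm | hm | hm | hm | hm | hm | hm | hm <;> omega
    · simp [Mirror]; omega
    · rintro ⟨v, hv, h⟩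
      simp [Sim, views, RestoreMove] at hv h
      rcases hv with rfl | rfl | rfl | rfl | rfl | rfl | rfl | rfl | rfl | rfl <;>
      simp at h <;> omega

/-- The last robot on the axis has joined one side, so the sides hold `a + b + 1` and `a + b`
robots. Each side is gathered into one block, and the difference of one prevents any return to
symmetry. -/
theorem Good.broken {m : ℕ} (hm : 4 ≤ m) (hm' : m % 2 = 0) (a b : ℕ)
    (hs : 2 * a + 2 * b + 1 = m + 3) : Good m ⟨0, b, a, a, b + 1⟩ := by
  by_cases h0 : a = 0
  · subst h0
    exact (Good.line hm hm' b (b + 1) (by omega) (by omega) (by omega)).of_sim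
      (by simp [Sim, views])
  by_cases h1 : a = 1
  · subst h1
    have h1 : Good m ⟨1, 0, b + 2, 0, b⟩ := by
      refine Good.free ?_ le_rfl ?_ ?_ ?_
      · exact (Good.line hm hm' (b + 1) (b + 2) (by omega) (by omega) (by omega)).of_sim
          (by simp [Sim, views, mv])
      · intro v hv ha hs
        simp [Sim, views] at hv
        rcases hv with rfl | rfl | rfl | rfl | rfl | rfl | rfl | rfl | rfl | rfl <;>
        simp [mv, Sim, views] at ha hs ⊢ <;> omega
      · simp [Mirror]; omega
      · rintro ⟨v, hv, h⟩
        simp [Sim, views, RestoreMove] at hv h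
        rcases hv with rfl | rfl | rfl | rfl | rfl | rfl | rfl | rfl | rfl | rfl <;>
        simp at h
    have h2 : Good m ⟨1, 1, b, 0, b + 1⟩ := by
      refine Good.free (h1.of_sim ?_) le_rfl ?_ ?_ ?_
      · simp [Sim, views, mv]
      · apply UniqueMove.of_le <;> simp [Mirror] <;> omega
      · simp [Mirror]; omega
      · rintro ⟨v, hv, h⟩
        simp [Sim, views, RestoreMove] at hv h
        rcases hv with rfl | rfl | rfl | rfl | rfl | rfl | rfl | rfl | rfl | rfl <;>
        simp at h <;> omega
    exact h2.of_sim (by simp [Sim, views])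
  · exact (Good.absorb hm hm' (b + 1) a a b (by omega) le_rfl (by omega) (by omega)).of_sim
      (by simp [Sim, views])

/-- Both ends of the axis gap pass a robot outwards; `3 ≤ c` makes these robots distinct and leaves
one between them. -/
theorem Good.apex {m a b c : ℕ} (hm : 4 ≤ m) (hm' : m % 2 = 0) (hc : 3 ≤ c)
    (hs : c + 2 * a + 2 * b = m + 3) (h : b = 0 ∨ a < b ∨ (a = b ∧ c < b))
    (hd : Good m ⟨c - 2, b + 1, a, a, b + 1⟩) : Good m ⟨c, b, a, a, b⟩ := by
  refine Good.mirror (h := ⟨c - 1, b + 1, a, a, b⟩) ?_ ?_ ?_ ?_ ?_ ?_ ?_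
  · simp [MirrorMove]; omega
  · simp [sum]; omega
  · simp [sum]; omega
  · simp [Const]; omega
  · simp [RestoreMove]; omega
  · simp [mv, Sim, views]
  · exact hd.of_sim (by simp [mv, Sim, views]; omega)

theorem Good.of_lt {m : ℕ} (hm : 4 ≤ m) (hm' : m % 2 = 0) :
    ∀ c a b : ℕ, a < b → c + 2 * a + 2 * b = m + 3 → Good m ⟨c, b, a, a, b⟩ := by
  intro c
  induction c using Nat.strong_induction_on with
  | _ c ih =>
    intro a b h hs
    by_cases hc : c = 1
    · subst hc
      have hM : MirrorMove ⟨1, b, a, a, b⟩ := by simp [MirrorMove]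
      refine ((Good.broken hm hm' a b (by omega)).of_sim ?_).step (.refl _)
        (hM.edge ?_ ?_ ?_)
      · simp [mv, Sim.refl]
      · simp [sum]; omega
      · simp [sum]; omega
      · simp [Const]; omega
    · exact Good.apex hm hm' (by omega) hs (by omega)
        (ih (c - 2) (by omega) a (b + 1) (by omega) (by omega))

theorem Good.of_eq {m : ℕ} (hm : 4 ≤ m) (hm' : m % 2 = 0) (c a : ℕ) (hca : c ≠ a)
    (hs : c + 4 * a = m + 3) : Good m ⟨c, a, a, a, a⟩ := by
  by_cases hc : c = 1
  · subst hc
    have hM : MirrorMove ⟨1, a, a, a, a⟩ := by simp [MirrorMove]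
    refine ((Good.broken hm hm' a a (by omega)).of_sim ?_).step (.refl _)
      (hM.edge ?_ ?_ ?_)
    · simp [mv, Sim.refl]
    · simp [sum]; omega
    · simp [sum]; omega
    · simp [Const]; omega
  by_cases h : a = 0 ∨ c < a
  · exact Good.apex hm hm' (by omega) (by omega) (by omega)
      (Good.of_lt hm hm' (c - 2) a (a + 1) (by omega) (by omega))
  -- Here `a < c`. For `c = a + 2`, taking a robot from the axis gap would give the symmetric vector
  -- `(a + 1, a + 1, a, a, a)`. So the gaps far from the axis gap feed those next to it instead.
  · have h1 : Good m ⟨a, a, a, c, a⟩ := by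
      refine Good.mirror (h := ⟨a, a - 1, a + 1, c, a⟩) ?_ ?_ ?_ ?_ ?_ ?_ ?_
      · simp [MirrorMove]; omega
      · simp [sum]; omega
      · simp [sum]; omega
      · simp [Const]; omega
      · simp [RestoreMove]; omega
      · simp [mv, Sim, views]
      · exact (Good.of_lt hm hm' c (a - 1) (a + 1) (by omega) (by omega)).of_sim
          (by simp [mv, Sim, views])
    exact h1.of_sim (by simp [Sim, views])

/-- Lexicographic descent on `(c, b)`: the gaps `b` next to the axis gap are emptied into the far
gaps `a`; once they are empty, the axis gap gives up two robots. -/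
theorem Good.of_gt {m : ℕ} (hm : 4 ≤ m) (hm' : m % 2 = 0) :
    ∀ c b a : ℕ, b < a → c + 2 * a + 2 * b = m + 3 → Good m ⟨c, b, a, a, b⟩ := by
  intro c
  induction c using Nat.strong_induction_on with
  | _ c ihc =>
    intro b
    induction b with
    | zero =>
      intro a h hs
      by_cases hc : c = 1
      · subst hc
        have hM : MirrorMove ⟨1, 0, a, a, 0⟩ := by simp [MirrorMove]
        refine ((Good.broken hm hm' a 0 (by omega)).of_sim ?_).step (.refl _)
          (hM.edge ?_ ?_ ?_)
        · simp [mv, Sim.refl]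
        · simp [sum]; omega
        · simp [sum]; omega
        · simp [Const]
      · refine Good.apex hm hm' (by omega) hs (by omega) ?_
        by_cases ha : a = 1
        · subst ha
          exact Good.of_eq hm hm' (c - 2) 1 (by omega) (by omega)
        · exact ihc (c - 2) (by omega) 1 a (by omega) (by omega)
    | succ b ihb =>
      intro a h hs
      by_cases hc : c = 1
      · subst hc
        have hM : MirrorMove ⟨1, b + 1, a, a, b + 1⟩ := by simp [MirrorMove]
        refine ((Good.broken hm hm' a (b + 1) (by omega)).of_sim ?_).step (.refl _)
          (hM.edge ?_ ?_ ?_)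
        · simp [mv, Sim.refl]
        · simp [sum]; omega
        · simp [sum]; omega
        · simp [Const]; omega
      · have h1 : Good m ⟨b + 1, c, b + 1, a, a⟩ := by
          refine Good.mirror (h := ⟨b + 1, c, b, a + 1, a⟩) ?_ ?_ ?_ ?_ ?_ ?_ ?_
          · simp [MirrorMove]; omega
          · simp [sum]; omega
          · simp [sum]; omega
          · simp [Const]; omega
          · simp [RestoreMove]; omega
          · simp [mv, Sim, views]
          · exact (ihb (a + 1) (by omega) (by omega)).of_sim (by simp [mv, Sim, views])
        exact h1.of_sim (by simp [Sim, views])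

theorem Good.of_mirror {m : ℕ} (hm : 4 ≤ m) (hm' : m % 2 = 0) {g : Gaps} (hs : g.sum = m + 3)
    (hc : ¬ g.Const) (h : g.Mirror) : Good m g := by
  have key : ∀ a b c : ℕ, c + 2 * a + 2 * b = m + 3 → ¬ (a = b ∧ c = a) →
      Good m ⟨c, b, a, a, b⟩ := by
    intro a b c hs h
    rcases lt_trichotomy a b with h' | rfl | h'
    · exact .of_lt hm hm' c a b h' hs
    · exact .of_eq hm hm' c a (by omega) (by omega)
    · exact .of_gt hm hm' c b a h' hs
  obtain ⟨a, b, c, d, e⟩ := g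
  simp only [sum, Const, Mirror] at *
  rcases h with ⟨rfl, rfl⟩ | ⟨rfl, rfl⟩ | ⟨rfl, rfl⟩ | ⟨rfl, rfl⟩ | ⟨rfl, rfl⟩
  · exact (key c b a (by omega) (by omega)).of_sim (by simp [Sim, views])
  · exact (key d c b (by omega) (by omega)).of_sim (by simp [Sim, views])
  · exact (key e d c (by omega) (by omega)).of_sim (by simp [Sim, views])
  · exact (key a e d (by omega) (by omega)).of_sim (by simp [Sim, views])
  · exact (key b a e (by omega) (by omega)).of_sim (by simp [Sim, views])

theorem RestoreMove.mirror_mv {g : Gaps} (h : g.RestoreMove) : g.mv.Mirror := by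
  simp only [RestoreMove, Mirror, mv] at *; omega

theorem RestoreMove.not_const_mv {g : Gaps} (h : g.RestoreMove) (hs7 : 7 ≤ g.sum) :
    ¬ g.mv.Const := by
  simp only [RestoreMove, Const, mv, sum] at *; omega

theorem Good.of_restorable {m : ℕ} (hm : 4 ≤ m) (hm' : m % 2 = 0) {g : Gaps}
    (hs : g.sum = m + 3) (h : g.Restorable) : Good m g := by
  obtain ⟨v, hv, h⟩ := h
  have hs' := hv.sum_eq
  exact (Good.of_mirror hm hm' (by rw [sum_mv h.one_le]; omega)
    (h.not_const_mv (by omega)) h.mirror_mv).step hv (h.edge (by omega) (by omega))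

/-- Serves when both neighbours of the largest gap are empty and a robot must first enter one of
them. -/
theorem UniqueMove.of_apart {g : Gaps} (h1 : 1 ≤ g.a) (h : g.a ≤ g.d ∧ g.b ≤ g.d)
    (h0 : g.c = 0 ∧ g.e = 0) (hs7 : 7 ≤ g.sum) (hs : ¬ g.Mirror) : g.UniqueMove := by
  obtain ⟨a, b, c, d, e⟩ := g
  rintro v hv ha hm
  simp only [Sim, views, List.mem_cons, List.not_mem_nil, or_false, mv, Mirror, sum] at *
  rcases hv with rfl | rfl | rfl | rfl | rfl | rfl | rfl | rfl | rfl | rfl <;>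
  simp only [mk.injEq] at * <;>
  rcases hm with hm | hm | hm | hm | hm | hm | hm | hm | hm | hm <;> omega

/-- The largest gap keeps growing, and `t` counts the robots outside it. A vector that is symmetric
or restorable is handed over to the previous results. -/
theorem Good.of_max {m : ℕ} (hm : 4 ≤ m) (hm' : m % 2 = 0) :
    ∀ (t : ℕ) (g : Gaps), g.sum = m + 3 → ¬ g.Const → g.sum = g.e + t →
      g.a ≤ g.e ∧ g.b ≤ g.e ∧ g.c ≤ g.e ∧ g.d ≤ g.e → Good m g := by
  intro t
  induction t with
  | zero =>
    rintro ⟨a, b, c, d, e⟩ hs hc ht hle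
    refine .of_mirror hm hm' hs hc ?_
    simp only [sum, Mirror] at *; omega
  | succ t ih =>
    have key : ∀ g : Gaps, g.sum = m + 3 → ¬ g.Const → g.sum = g.e + (t + 1) →
        g.a ≤ g.e ∧ g.b ≤ g.e ∧ g.c ≤ g.e ∧ g.d ≤ g.e → 1 ≤ g.a → Good m g := by
      intro g hs hc ht hle ha
      by_cases h : g.Mirror
      · exact .of_mirror hm hm' hs hc h
      by_cases h' : g.Restorable
      · exact .of_restorable hm hm' hs h'
      refine Good.free (ih _ ?_ ?_ ?_ ?_) ha (.of_le hle h) h h'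
      · rw [sum_mv ha, hs]
      · simp only [Const, mv]; omega
      · rw [sum_mv ha, ht]; simp only [mv]; omega
      · simp only [mv]; omega
    rintro ⟨a, b, c, d, e⟩ hs hc ht hle
    by_cases ha : 1 ≤ a
    · exact key _ hs hc ht hle ha
    by_cases hd : 1 ≤ d
    · refine (key ⟨d, c, b, a, e⟩ ?_ ?_ ?_ ?_ hd).of_sim (by simp [Sim, views])
      all_goals simp only [sum, Const] at *; omega
    -- Both neighbours of the largest gap are empty: a robot enters one of them, and `key` then
    -- takes it into the largest gap.
    have zero : ∀ b c : ℕ, b + c + e = m + 3 → b + c = t + 1 → b ≤ e → c ≤ e → 1 ≤ b →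
        Good m ⟨b, c, 0, e, 0⟩ := by
      intro b c hs ht hb hc h1
      have hs' : sum ⟨b, c, 0, e, 0⟩ = m + 3 := by simp only [sum]; omega
      by_cases h : Mirror ⟨b, c, 0, e, 0⟩
      · refine .of_mirror hm hm' hs' ?_ h
        simp only [Const]; omega
      by_cases h' : Restorable ⟨b, c, 0, e, 0⟩
      · exact .of_restorable hm hm' hs' h'
      refine Good.free ?_ h1 ?_ h h'
      · refine (key ⟨1, b - 1, c, 0, e⟩ ?_ ?_ ?_ ?_ le_rfl).of_sim (by simp [Sim, views, mv])
        all_goals simp only [sum, Const]; omega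
      · exact .of_apart h1 ⟨hb, hc⟩ ⟨rfl, rfl⟩ (by omega) h
    obtain rfl : a = 0 := by omega
    obtain rfl : d = 0 := by omega
    simp only [sum] at *
    by_cases hb : 1 ≤ b
    · exact (zero b c (by omega) (by omega) (by omega) (by omega) hb).of_sim
        (by simp [Sim, views])
    · exact (zero c b (by omega) (by omega) (by omega) (by omega) (by omega)).of_sim
        (by simp [Sim, views])

/-- The permanent regime can be reached from everywhere. -/
theorem Good.of_not_const {m : ℕ} (hm : 4 ≤ m) (hm' : m % 2 = 0) {g : Gaps}
    (hs : g.sum = m + 3) (hc : ¬ g.Const) : Good m g := by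
  have key : ∃ v, g.Sim v ∧ v.a ≤ v.e ∧ v.b ≤ v.e ∧ v.c ≤ v.e ∧ v.d ≤ v.e := by
    obtain ⟨a, b, c, d, e⟩ := g
    by_cases h : a ≤ e ∧ b ≤ e ∧ c ≤ e ∧ d ≤ e
    · exact ⟨⟨a, b, c, d, e⟩, by simp [Sim, views], h⟩
    by_cases h : b ≤ a ∧ c ≤ a ∧ d ≤ a ∧ e ≤ a
    · exact ⟨⟨b, c, d, e, a⟩, by simp [Sim, views], h⟩
    by_cases h : c ≤ b ∧ d ≤ b ∧ e ≤ b ∧ a ≤ b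
    · exact ⟨⟨c, d, e, a, b⟩, by simp [Sim, views], h⟩
    by_cases h : d ≤ c ∧ e ≤ c ∧ a ≤ c ∧ b ≤ c
    · exact ⟨⟨d, e, a, b, c⟩, by simp [Sim, views], h⟩
    · exact ⟨⟨e, a, b, c, d⟩, by simp [Sim, views], by simp only; omega⟩
  obtain ⟨v, hv, hle⟩ := key
  have hs' := hv.sum_eq
  refine (Good.of_max hm hm' (v.a + v.b + v.c + v.d) v (by omega)
    (fun h => hc (hv.symm.const h)) (by simp only [sum]; omega) hle).of_sim hv

end Gaps
end RingRobots

/-! ### Gap vectors as configurations on the ring -/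

namespace RingRobots

theorem dir_mul_self {n : ℕ} {s : ZMod n} (hs : s = 1 ∨ s = -1) : s * s = 1 := by
  rcases hs with rfl | rfl <;> ring

/-- The configuration with the gaps `g`, seen from the free node `y` in the direction `s`. -/
def conf {n : ℕ} (y s : ZMod n) (g : Gaps) : Config n :=
  {x | x ≠ y ∧ x ≠ y + s * ((g.a + 1 : ℕ) : ZMod n) ∧ x ≠ y + s * ((g.a + g.b + 2 : ℕ) : ZMod n) ∧
    x ≠ y + s * ((g.a + g.b + g.c + 3 : ℕ) : ZMod n) ∧
    x ≠ y + s * ((g.a + g.b + g.c + g.d + 4 : ℕ) : ZMod n)}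

section
variable {n : ℕ}

theorem cast_total {a b c d e : ℕ} (hn : (Gaps.mk a b c d e).sum + 5 = n) :
    (a : ZMod n) + b + c + d + e + 5 = 0 := by
  have h := congrArg (Nat.cast : ℕ → ZMod n) hn
  simpa [Gaps.sum] using h

theorem conf_rot (y s : ZMod n) {a b c d e : ℕ} (hn : (Gaps.mk a b c d e).sum + 5 = n) :
    conf y s ⟨a, b, c, d, e⟩ = conf (y + s * ((a + 1 : ℕ) : ZMod n)) s ⟨b, c, d, e, a⟩ := by
  have h := cast_total hn
  have e1 : y + s * ((a + 1 : ℕ) : ZMod n) + s * ((b + 1 : ℕ) : ZMod n) =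
    y + s * ((a + b + 2 : ℕ) : ZMod n) := by push_cast; ring
  have e2 : y + s * ((a + 1 : ℕ) : ZMod n) + s * ((b + c + 2 : ℕ) : ZMod n) =
    y + s * ((a + b + c + 3 : ℕ) : ZMod n) := by push_cast; ring
  have e3 : y + s * ((a + 1 : ℕ) : ZMod n) + s * ((b + c + d + 3 : ℕ) : ZMod n) =
    y + s * ((a + b + c + d + 4 : ℕ) : ZMod n) := by push_cast; ring
  have e4 : y + s * ((a + 1 : ℕ) : ZMod n) + s * ((b + c + d + e + 4 : ℕ) : ZMod n) = y := by
    push_cast; linear_combination s * h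
  ext x
  simp only [conf, Set.mem_ofPred_eq, e1, e2, e3, e4]
  tauto

theorem conf_flip (y s : ZMod n) {a b c d e : ℕ} (hn : (Gaps.mk a b c d e).sum + 5 = n) :
    conf y s ⟨a, b, c, d, e⟩ = conf y (-s) ⟨e, d, c, b, a⟩ := by
  have h := cast_total hn
  have e1 : y + -s * ((e + 1 : ℕ) : ZMod n) = y + s * ((a + b + c + d + 4 : ℕ) : ZMod n) := by
    push_cast; linear_combination -s * h
  have e2 : y + -s * ((e + d + 2 : ℕ) : ZMod n) = y + s * ((a + b + c + 3 : ℕ) : ZMod n) := by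
    push_cast; linear_combination -s * h
  have e3 : y + -s * ((e + d + c + 3 : ℕ) : ZMod n) = y + s * ((a + b + 2 : ℕ) : ZMod n) := by
    push_cast; linear_combination -s * h
  have e4 : y + -s * ((e + d + c + b + 4 : ℕ) : ZMod n) = y + s * ((a + 1 : ℕ) : ZMod n) := by
    push_cast; linear_combination -s * h
  ext x
  simp only [conf, Set.mem_ofPred_eq, e1, e2, e3, e4]
  tauto

theorem add_mul_inj {y s : ZMod n} (hs : s = 1 ∨ s = -1) {i j : ZMod n}
    (h : y + s * i = y + s * j) : i = j := by
  linear_combination s * h - (i - j) * dir_mul_self hs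

theorem add_mul_cast_inj {y s : ZMod n} (hs : s = 1 ∨ s = -1) {i j : ℕ} (hi : i < n) (hj : j < n)
    (h : y + s * (i : ZMod n) = y + s * (j : ZMod n)) : i = j := by
  have h := add_mul_inj hs h
  rwa [ZMod.natCast_eq_natCast_iff', Nat.mod_eq_of_lt hi, Nat.mod_eq_of_lt hj] at h

theorem mem_conf_iff {y s : ZMod n} (hs : s = 1 ∨ s = -1) {g : Gaps} (hn : g.sum + 5 = n) {j : ℕ}
    (hj : j < n) : y + s * (j : ZMod n) ∈ conf y s g ↔
      j ≠ 0 ∧ j ≠ g.a + 1 ∧ j ≠ g.a + g.b + 2 ∧ j ≠ g.a + g.b + g.c + 3 ∧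
        j ≠ g.a + g.b + g.c + g.d + 4 := by
  have key : ∀ i : ℕ, i < n → (y + s * (j : ZMod n) ≠ y + s * (i : ZMod n) ↔ j ≠ i) := fun i hi =>
    not_congr ⟨add_mul_cast_inj hs hj hi, fun h => by rw [h]⟩
  have h0 := key 0 (by omega)
  simp only [Nat.cast_zero, mul_zero, add_zero] at h0
  simp only [Gaps.sum] at hn
  simp only [conf, Set.mem_ofPred_eq]
  rw [h0, key _ (by omega), key _ (by omega), key _ (by omega), key _ (by omega)]

theorem conf_inj {y s : ZMod n} (hs : s = 1 ∨ s = -1) {g g' : Gaps} (hn : g.sum + 5 = n)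
    (hn' : g'.sum + 5 = n) (h : conf y s g = conf y s g') : g' = g := by
  have key : ∀ j : ℕ, j < n → _ := fun j hj =>
    (mem_conf_iff hs hn hj).symm.trans ((Set.ext_iff.1 h _).trans (mem_conf_iff (y := y) hs hn' hj))
  obtain ⟨a, b, c, d, e⟩ := g
  obtain ⟨a', b', c', d', e'⟩ := g'
  simp only [Gaps.sum] at *
  have k1 := key (a + 1) (by omega)
  have k1' := key (a' + 1) (by omega)
  obtain rfl : a' = a := by omega
  clear k1 k1'
  have k2 := key (a' + b + 2) (by omega)
  have k2' := key (a' + b' + 2) (by omega)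
  obtain rfl : b' = b := by omega
  clear k2 k2'
  have k3 := key (a' + b' + c + 3) (by omega)
  have k3' := key (a' + b' + c' + 3) (by omega)
  obtain rfl : c' = c := by omega
  clear k3 k3'
  have k4 := key (a' + b' + c' + d + 4) (by omega)
  have k4' := key (a' + b' + c' + d' + 4) (by omega)
  obtain rfl : d' = d := by omega
  obtain rfl : e' = e := by omega
  rfl

/-- The node `y'` is free, hence one of the five free nodes seen from `y`; rotating the view to it
reduces to `conf_inj`. -/
theorem eq_of_conf_eq {y y' s : ZMod n} (hs : s = 1 ∨ s = -1) {a b c d e : ℕ} {g' : Gaps}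
    (hn : (Gaps.mk a b c d e).sum + 5 = n) (hn' : g'.sum + 5 = n)
    (h : conf y s ⟨a, b, c, d, e⟩ = conf y' s g') :
    (y' = y ∧ g' = ⟨a, b, c, d, e⟩) ∨ (g' = ⟨b, c, d, e, a⟩) ∨ (g' = ⟨c, d, e, a, b⟩) ∨
      (g' = ⟨d, e, a, b, c⟩) ∨ (g' = ⟨e, a, b, c, d⟩) := by
  have h1 := conf_rot y s hn
  have n1 : (Gaps.mk b c d e a).sum + 5 = n := by simp only [Gaps.sum] at *; omega
  have h2 := h1.trans (conf_rot _ s n1)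
  have n2 : (Gaps.mk c d e a b).sum + 5 = n := by simp only [Gaps.sum] at *; omega
  have h3 := h2.trans (conf_rot _ s n2)
  have n3 : (Gaps.mk d e a b c).sum + 5 = n := by simp only [Gaps.sum] at *; omega
  have h4 := h3.trans (conf_rot _ s n3)
  have n4 : (Gaps.mk e a b c d).sum + 5 = n := by simp only [Gaps.sum] at *; omega
  have hy : y' ∉ conf y s ⟨a, b, c, d, e⟩ := by rw [h]; simp [conf]
  have e2 : y + s * ((a + 1 : ℕ) : ZMod n) + s * ((b + 1 : ℕ) : ZMod n) =
    y + s * ((a + b + 2 : ℕ) : ZMod n) := by push_cast; ring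
  have e3 : y + s * ((a + b + 2 : ℕ) : ZMod n) + s * ((c + 1 : ℕ) : ZMod n) =
    y + s * ((a + b + c + 3 : ℕ) : ZMod n) := by push_cast; ring
  have e4 : y + s * ((a + b + c + 3 : ℕ) : ZMod n) + s * ((d + 1 : ℕ) : ZMod n) =
    y + s * ((a + b + c + d + 4 : ℕ) : ZMod n) := by push_cast; ring
  rw [e2] at h2 h3 h4
  rw [e3] at h3 h4
  rw [e4] at h4
  simp only [conf, Set.mem_ofPred_eq, not_and_or, not_not] at hy
  rcases hy with rfl | rfl | rfl | rfl | rfl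
  · exact .inl ⟨rfl, conf_inj hs hn hn' h⟩
  · exact .inr (.inl (conf_inj hs n1 hn' (h1.symm.trans h)))
  · exact .inr (.inr (.inl (conf_inj hs n2 hn' (h2.symm.trans h))))
  · exact .inr (.inr (.inr (.inl (conf_inj hs n3 hn' (h3.symm.trans h)))))
  · exact .inr (.inr (.inr (.inr (conf_inj hs n4 hn' (h4.symm.trans h)))))

theorem eq_or_eq_neg {s s' : ZMod n} (hs : s = 1 ∨ s = -1) (hs' : s' = 1 ∨ s' = -1) :
    s' = s ∨ s' = -s := by
  rcases hs with rfl | rfl <;> rcases hs' with rfl | rfl <;> simp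

theorem neg_dir {s : ZMod n} (hs : s = 1 ∨ s = -1) : -s = 1 ∨ -s = -1 := by
  rcases hs with rfl | rfl <;> simp

/-- Two such nodes would give a nontrivial rotation of five cyclic gaps. As 5 is prime, all gaps
would be equal. -/
theorem node_unique {y y' s : ZMod n} (hs : s = 1 ∨ s = -1) {g : Gaps} (hn : g.sum + 5 = n)
    (hc : ¬ g.Const) (h : conf y s g = conf y' s g) : y' = y := by
  obtain ⟨a, b, c, d, e⟩ := g
  simp only [Gaps.Const] at hc
  rcases eq_of_conf_eq hs hn hn h with h | h | h | h | h
  · exact h.1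
  all_goals simp only [Gaps.mk.injEq] at h; omega

theorem Gaps.Sim.of_conf_eq {y y' s s' : ZMod n} (hs : s = 1 ∨ s = -1) (hs' : s' = 1 ∨ s' = -1)
    {g g' : Gaps} (hn : g.sum + 5 = n) (hn' : g'.sum + 5 = n) (h : conf y s g = conf y' s' g') :
    g.Sim g' := by
  obtain ⟨a, b, c, d, e⟩ := g
  rcases eq_or_eq_neg hs hs' with rfl | rfl
  · rcases eq_of_conf_eq hs hn hn' h with h | h | h | h | h <;> simp [h, Sim, views]
  · rw [conf_flip y s hn] at h
    rcases eq_of_conf_eq hs' (by simp only [sum] at *; omega) hn' h with h | h | h | h | h <;>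
    simp [h, Sim, views]

theorem Gaps.Sim.exists_conf {g v : Gaps} (H : g.Sim v) (hn : g.sum + 5 = n) {y s : ZMod n}
    (hs : s = 1 ∨ s = -1) : ∃ y' s' : ZMod n, (s' = 1 ∨ s' = -1) ∧ conf y s g = conf y' s' v := by
  have key : ∀ a b c d e : ℕ, (Gaps.mk a b c d e).sum + 5 = n → ∀ y s : ZMod n,
      (s = 1 ∨ s = -1) → ∀ v, (v = ⟨a, b, c, d, e⟩ ∨ (v = ⟨b, c, d, e, a⟩) ∨
        (v = ⟨c, d, e, a, b⟩) ∨ (v = ⟨d, e, a, b, c⟩) ∨ (v = ⟨e, a, b, c, d⟩)) →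
      ∃ y' s' : ZMod n, (s' = 1 ∨ s' = -1) ∧ conf y s ⟨a, b, c, d, e⟩ = conf y' s' v := by
    intro a b c d e hn y s hs v hv
    have n1 : (Gaps.mk b c d e a).sum + 5 = n := by simp only [Gaps.sum] at *; omega
    have n2 : (Gaps.mk c d e a b).sum + 5 = n := by simp only [Gaps.sum] at *; omega
    have n3 : (Gaps.mk d e a b c).sum + 5 = n := by simp only [Gaps.sum] at *; omega
    rcases hv with rfl | rfl | rfl | rfl | rfl
    · exact ⟨_, s, hs, rfl⟩
    · exact ⟨_, s, hs, conf_rot _ _ hn⟩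
    · exact ⟨_, s, hs, (conf_rot _ _ hn).trans (conf_rot _ _ n1)⟩
    · exact ⟨_, s, hs, ((conf_rot _ _ hn).trans (conf_rot _ _ n1)).trans (conf_rot _ _ n2)⟩
    · exact ⟨_, s, hs, (((conf_rot _ _ hn).trans (conf_rot _ _ n1)).trans
        (conf_rot _ _ n2)).trans (conf_rot _ _ n3)⟩
  obtain ⟨a, b, c, d, e⟩ := g
  have key' := key e d c b a (by simp only [sum] at *; omega) y (-s) (neg_dir hs) v
  rw [← conf_flip y s hn] at key'
  simp only [Sim, views, List.mem_cons, List.not_mem_nil, or_false] at H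
  rcases H with H | H | H | H | H | H | H | H | H | H
  · exact key a b c d e hn y s hs v (by simp [H])
  · exact key a b c d e hn y s hs v (by simp [H])
  · exact key a b c d e hn y s hs v (by simp [H])
  · exact key a b c d e hn y s hs v (by simp [H])
  · exact key a b c d e hn y s hs v (by simp [H])
  all_goals exact key' (by simp [H])

/-- The photo with the gaps `g`. -/
def gapPhoto (n : ℕ) (g : Gaps) : Photo n := photo (conf 0 1 g)

theorem mem_conf_zero_iff {y s : ZMod n} (hs : s = 1 ∨ s = -1) (g : Gaps) (x : ZMod n) :
    x ∈ conf (0 : ZMod n) 1 g ↔ y + s * x ∈ conf y s g := by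
  have key : ∀ i : ZMod n, y + s * x ≠ y + s * i ↔ x ≠ i := fun i =>
    not_congr ⟨add_mul_inj hs, fun h => by rw [h]⟩
  have h0 := key 0
  simp only [mul_zero, add_zero] at h0
  simp only [conf, Set.mem_ofPred_eq, zero_add, one_mul]
  rw [h0, key, key, key, key]

theorem photo_conf {y s : ZMod n} (hs : s = 1 ∨ s = -1) (g : Gaps) :
    photo (conf y s g) = gapPhoto n g :=
  Quotient.sound ⟨y, s, hs, mem_conf_zero_iff hs g⟩

theorem exists_conf_of_photo_eq {C : Config n} {g : Gaps} (h : photo C = gapPhoto n g) :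
    ∃ y s : ZMod n, (s = 1 ∨ s = -1) ∧ C = conf y s g := by
  obtain ⟨y, s, hs, H⟩ := Quotient.exact h
  refine ⟨y, s, hs, ?_⟩
  ext x
  have h1 := (H (s * (x - y))).symm.trans (mem_conf_zero_iff (y := y) hs g (s * (x - y)))
  have h2 : y + s * (s * (x - y)) = x := by linear_combination (x - y) * dir_mul_self hs
  rwa [h2] at h1

theorem gapPhoto_eq_iff {g g' : Gaps} (hn : g.sum + 5 = n) (hn' : g'.sum + 5 = n) :
    gapPhoto n g = gapPhoto n g' ↔ g.Sim g' := by
  constructor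
  · intro h
    obtain ⟨y, s, hs, H⟩ := exists_conf_of_photo_eq h
    exact .of_conf_eq (.inl rfl) hs hn hn' H
  · intro h
    obtain ⟨y, s, hs, H⟩ := h.exists_conf hn (y := 0) (.inl rfl)
    rw [gapPhoto, H, photo_conf hs]

theorem exists_conf [NeZero n] {C : Config n} (hC : (Cᶜ).ncard = 5) {y s : ZMod n} (hy : y ∉ C)
    (hs : s = 1 ∨ s = -1) : ∃ g : Gaps, g.sum + 5 = n ∧ C = conf y s g := by
  classical
  set T : Finset ℕ := (Finset.range n).filter fun j => y + s * (j : ZMod n) ∉ C with hT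
  have hval : ∀ x : ZMod n, y + s * (((s * (x - y)).val : ℕ) : ZMod n) = x := fun x => by
    rw [ZMod.natCast_zmod_val]; linear_combination (x - y) * dir_mul_self hs
  have himg : Cᶜ = ((T.image fun j : ℕ => y + s * (j : ZMod n) : Finset (ZMod n)) :
      Set (ZMod n)) := by
    ext x
    simp only [Set.mem_compl_iff, Finset.coe_image, Set.mem_image, Finset.mem_coe, hT,
      Finset.mem_filter, Finset.mem_range]
    constructor
    · intro hx
      refine ⟨(s * (x - y)).val, ⟨ZMod.val_lt _, ?_⟩, hval x⟩
      rwa [hval]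
    · rintro ⟨j, ⟨_, h⟩, rfl⟩
      exact h
  have hcard : T.card = 5 := by
    rw [himg, Set.ncard_coe_finset, Finset.card_image_of_injOn] at hC
    · exact hC
    · intro i hi j hj h
      simp only [hT, Finset.coe_filter, Finset.mem_range, Set.mem_ofPred_eq] at hi hj
      exact add_mul_cast_inj hs hi.1 hj.1 h
  -- The offsets of the free nodes from `y`, in increasing order. The first is 0, and the gaps are
  -- the successive differences minus one.
  set o := T.orderEmbOfFin hcard with ho
  have hlt : ∀ i j : Fin 5, i < j → o i < o j := fun i j h => o.strictMono h
  have h01 := hlt 0 1 (by decide)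
  have h12 := hlt 1 2 (by decide)
  have h23 := hlt 2 3 (by decide)
  have h34 := hlt 3 4 (by decide)
  have hmem : ∀ j, j ∈ T ↔ ∃ i, o i = j := fun j => by
    have := Finset.range_orderEmbOfFin T hcard
    rw [← Finset.mem_coe, ← this, Set.mem_range]
  have h4 : o 4 < n := by
    have := (hmem (o 4)).2 ⟨4, rfl⟩
    simp only [hT, Finset.mem_filter, Finset.mem_range] at this
    exact this.1
  have h0 : o 0 = 0 := by
    have h0T : 0 ∈ T := by
      simp [hT, hy, Nat.pos_of_ne_zero (NeZero.ne n)]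
    obtain ⟨i, hi⟩ := (hmem 0).1 h0T
    have : o 0 ≤ o i := o.monotone (Fin.zero_le i)
    omega
  have hn : (Gaps.mk (o 1 - 1) (o 2 - o 1 - 1) (o 3 - o 2 - 1) (o 4 - o 3 - 1)
      (n - 1 - o 4)).sum + 5 = n := by
    simp only [Gaps.sum]; omega
  refine ⟨_, hn, ?_⟩
  ext x
  have h1 := mem_conf_iff (y := y) hs hn (ZMod.val_lt (s * (x - y)))
  rw [hval] at h1
  simp only at h1
  rw [h1]
  have h2 := hmem (s * (x - y)).val
  simp only [hT, Finset.mem_filter, Finset.mem_range, ZMod.val_lt, true_and, hval] at h2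
  rw [← not_iff_not, h2, Fin.exists_fin_succ, Fin.exists_fin_succ, Fin.exists_fin_succ,
    Fin.exists_fin_succ, Fin.exists_fin_succ]
  simp only [not_and_or, not_not]
  generalize (s * (x - y)).val = j
  change (o 0 = j ∨ o 1 = j ∨ o 2 = j ∨ o 3 = j ∨ o 4 = j ∨ _) ↔ _
  simp only [IsEmpty.exists_iff, or_false]
  clear h1 h2 hmem
  omega

/-- The robot next to the free node `y` in the direction `s` moves to `y`. -/
theorem mem_conf_mv {y s : ZMod n} (hs : s = 1 ∨ s = -1) {g : Gaps} (hn : g.sum + 5 = n)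
    (ha : 1 ≤ g.a) (x : ZMod n) :
    x ∈ conf (y + s) s g.mv ↔ x = y ∨ (x ∈ conf y s g ∧ x ≠ y + s) := by
  have e1 : y + s + s * ((g.a - 1 + 1 : ℕ) : ZMod n) = y + s * ((g.a + 1 : ℕ) : ZMod n) := by
    rw [Nat.sub_add_cancel ha]; push_cast; ring
  have e2 : y + s + s * ((g.a - 1 + g.b + 2 : ℕ) : ZMod n) =
      y + s * ((g.a + g.b + 2 : ℕ) : ZMod n) := by
    rw [show g.a - 1 + g.b + 2 = g.a + g.b + 1 by omega]; push_cast; ring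
  have e3 : y + s + s * ((g.a - 1 + g.b + g.c + 3 : ℕ) : ZMod n) =
      y + s * ((g.a + g.b + g.c + 3 : ℕ) : ZMod n) := by
    rw [show g.a - 1 + g.b + g.c + 3 = g.a + g.b + g.c + 2 by omega]; push_cast; ring
  have e4 : y + s + s * ((g.a - 1 + g.b + g.c + g.d + 4 : ℕ) : ZMod n) =
      y + s * ((g.a + g.b + g.c + g.d + 4 : ℕ) : ZMod n) := by
    rw [show g.a - 1 + g.b + g.c + g.d + 4 = g.a + g.b + g.c + g.d + 3 by omega]; push_cast; ring
  have key : ∀ j : ℕ, 0 < j → j < n → y ≠ y + s * (j : ZMod n) := by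
    intro j h0 hj h
    have := add_mul_cast_inj (y := y) hs (i := 0) (by omega) hj (by simpa using h)
    omega
  simp only [Gaps.sum] at hn
  have k0 : y ≠ y + s := by simpa using key 1 (by omega) (by omega)
  have k1 := key (g.a + 1) (by omega) (by omega)
  have k2 := key (g.a + g.b + 2) (by omega) (by omega)
  have k3 := key (g.a + g.b + g.c + 3) (by omega) (by omega)
  have k4 := key (g.a + g.b + g.c + g.d + 4) (by omega) (by omega)
  simp only [conf, Gaps.mv, Set.mem_ofPred_eq, e1, e2, e3, e4]
  by_cases hx : x = y
  · subst hx
    exact iff_of_true ⟨k0, k1, k2, k3, k4⟩ (.inl rfl)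
  · simp only [hx, ne_eq, not_false_eq_true, true_and, false_or]
    tauto

end
end RingRobots

/-! ### The algorithm and the decisions it allows -/

namespace RingRobots

/-- Equal gaps are symmetric, but with at least seven robots they satisfy no clause of `MirrorMove`;
so no allowed move starts there. -/
theorem Gaps.Dist.not_const {m t : ℕ} (hm : 4 ≤ m) {g : Gaps} (hs : g.sum = m + 3)
    (h : Gaps.Dist m g t) : ¬ g.Const := by
  intro hc
  cases h with
  | perm i h => exact not_const_of_not_mirror (not_mirror_perm hm i) (h.const hc)
  | @step _ v _ h he hd =>
    have hs' := h.sum_eq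
    have hc' := h.const hc
    have h1 := he.2.2.1 (by simp only [Const, Mirror] at *; omega)
    simp only [Const, MirrorMove, sum] at *
    omega

section
variable {n : ℕ}

theorem gapPhoto_mv_perm {m : ℕ} (hn : n = m + 8) (i : Fin 5) :
    gapPhoto n (Gaps.perm m i).mv = gapPhoto n (Gaps.perm m (i + 1)) := by
  have h := Gaps.sum_perm m i
  have h1 := Gaps.sum_mv (Gaps.one_le_perm_a m i)
  have h2 := Gaps.sum_perm m (i + 1)
  rw [gapPhoto_eq_iff (by omega) (by omega), Gaps.mv_perm]
  simp [Gaps.Sim, Gaps.views]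

open Classical in
/-- In the permanent regime follow the cycle; otherwise make a legal move on a shortest path to the
permanent regime. -/
noncomputable def algorithm (n m : ℕ) : Algorithm n := fun S =>
  if h : ∃ i, S = gapPhoto n (Gaps.perm m i) then some (gapPhoto n (Gaps.perm m (h.choose + 1)))
  else if h : ∃ t v, Gaps.sum v = m + 3 ∧ S = gapPhoto n v ∧ v.Edge ∧ Gaps.Dist m v.mv t then
    some (gapPhoto n (Nat.find_spec h).choose.mv)
  else none

/-- The distance of a photo to the permanent regime. -/
noncomputable def rank (m : ℕ) (S : Photo n) : ℕ :=
  sInf {t | ∃ g : Gaps, g.sum = m + 3 ∧ S = gapPhoto n g ∧ Gaps.Dist m g t}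

theorem algorithm_perm {m : ℕ} (hm : 4 ≤ m) (hn : n = m + 8) (i : Fin 5) :
    algorithm n m (gapPhoto n (Gaps.perm m i)) = some (gapPhoto n (Gaps.perm m (i + 1))) := by
  have h : ∃ j, gapPhoto n (Gaps.perm m i) = gapPhoto n (Gaps.perm m j) := ⟨i, rfl⟩
  have hi := h.choose_spec
  have s1 := Gaps.sum_perm m i
  have s2 := Gaps.sum_perm m h.choose
  rw [gapPhoto_eq_iff (by omega) (by omega)] at hi
  rw [algorithm, dif_pos h, ← Gaps.perm_unique hm hi]

theorem rank_perm (m : ℕ) (i : Fin 5) : rank m (gapPhoto n (Gaps.perm m i)) = 0 :=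
  Nat.le_zero.1 (Nat.sInf_le ⟨_, Gaps.sum_perm m i, rfl, .perm i (.refl _)⟩)

theorem exists_perm_of_rank_eq_zero {m : ℕ} (hm : 4 ≤ m) (hm' : m % 2 = 0) (hn : n = m + 8)
    {g : Gaps} (hs : g.sum = m + 3) (hc : ¬ g.Const) (h : rank m (gapPhoto n g) = 0) :
    ∃ i, gapPhoto n g = gapPhoto n (Gaps.perm m i) := by
  obtain ⟨t, ht⟩ := Gaps.Good.of_not_const hm hm' hs hc
  have hne : {t | ∃ g' : Gaps, g'.sum = m + 3 ∧ gapPhoto n g = gapPhoto n g' ∧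
      Gaps.Dist m g' t}.Nonempty := ⟨t, g, hs, rfl, ht⟩
  have := Nat.sInf_mem hne
  rw [show sInf _ = 0 from h] at this
  obtain ⟨g', hs', hg, hd⟩ := this
  cases hd with
  | perm i h' =>
    have s1 := Gaps.sum_perm m i
    exact ⟨i, hg.trans ((gapPhoto_eq_iff (by omega) (by omega)).2 h')⟩

/-- `v` is the view of the gaps `g` in which the algorithm moves. -/
def Designated (n m : ℕ) (g v : Gaps) : Prop :=
  g.Sim v ∧ v.Edge ∧ ¬ v.mv.Const ∧ algorithm n m (gapPhoto n g) = some (gapPhoto n v.mv) ∧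
    (rank m (gapPhoto n v.mv) < rank m (gapPhoto n g) ∨ rank m (gapPhoto n v.mv) = 0)

theorem designated_of_sim_perm {m : ℕ} (hm : 4 ≤ m) (hm' : m % 2 = 0) (hn : n = m + 8) {g : Gaps}
    {i : Fin 5} (h : g.Sim (Gaps.perm m i)) : Designated n m g (Gaps.perm m i) := by
  have s1 := Gaps.sum_perm m i
  have s2 := h.sum_eq
  refine ⟨h, Gaps.edge_perm hm hm' i, ?_, ?_, ?_⟩
  · rw [Gaps.mv_perm]
    have := Gaps.not_const_of_not_mirror (Gaps.not_mirror_perm hm (i + 1))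
    simp only [Gaps.Const] at *; omega
  · rw [(gapPhoto_eq_iff (by omega) (by omega)).2 h, algorithm_perm hm hn, gapPhoto_mv_perm hn]
  · right; rw [gapPhoto_mv_perm hn, rank_perm]

theorem exists_designated {m : ℕ} (hm : 4 ≤ m) (hm' : m % 2 = 0) (hn : n = m + 8) {g : Gaps}
    (hs : g.sum = m + 3) (hc : ¬ g.Const) : ∃ v, Designated n m g v := by
  by_cases h : ∃ i, gapPhoto n g = gapPhoto n (Gaps.perm m i)
  · obtain ⟨i, hi⟩ := h
    have s1 := Gaps.sum_perm m i
    rw [gapPhoto_eq_iff (by omega) (by omega)] at hi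
    exact ⟨_, designated_of_sim_perm hm hm' hn hi⟩
  -- Off the cycle, a path has a first move, and the rest of the path is one shorter.
  · have step : ∀ t, (∃ g' : Gaps, g'.sum = m + 3 ∧ gapPhoto n g = gapPhoto n g' ∧
        Gaps.Dist m g' t) → ∃ t', t = t' + 1 ∧ ∃ v : Gaps, v.sum = m + 3 ∧
          gapPhoto n g = gapPhoto n v ∧ v.Edge ∧ Gaps.Dist m v.mv t' := by
      rintro t ⟨g', hs', hg, hd⟩
      cases hd with
      | perm i h' =>
        have s1 := Gaps.sum_perm m i
        exact absurd ⟨i, hg.trans ((gapPhoto_eq_iff (by omega) (by omega)).2 h')⟩ h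
      | @step _ v t' h' he hd =>
        have s1 := h'.sum_eq
        exact ⟨t', rfl, v, by omega,
          hg.trans ((gapPhoto_eq_iff (by omega) (by omega)).2 h'), he, hd⟩
    obtain ⟨t, ht⟩ := Gaps.Good.of_not_const hm hm' hs hc
    have hne : {t | ∃ g' : Gaps, g'.sum = m + 3 ∧ gapPhoto n g = gapPhoto n g' ∧
      Gaps.Dist m g' t}.Nonempty := ⟨t, g, hs, rfl, ht⟩
    obtain ⟨t', ht', hv⟩ := step _ (Nat.sInf_mem hne)
    classical
    have H : ∃ t v, Gaps.sum v = m + 3 ∧ gapPhoto n g = gapPhoto n v ∧ v.Edge ∧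
      Gaps.Dist m v.mv t := ⟨t', hv⟩
    have hfind := Nat.find_min' H hv
    obtain ⟨s1, s2, s3, s4⟩ := (Nat.find_spec H).choose_spec
    have s5 := Gaps.sum_mv s3.1
    refine ⟨(Nat.find_spec H).choose, (gapPhoto_eq_iff (by omega) (by omega)).1 s2, s3,
      s4.not_const hm (by omega), ?_, .inl ?_⟩
    · rw [algorithm, dif_neg h, dif_pos H]
    · have h1 : rank m (gapPhoto n (Nat.find_spec H).choose.mv) ≤ Nat.find H :=
        Nat.sInf_le ⟨_, by omega, rfl, s4⟩
      have h2 : rank m (gapPhoto n g) = t' + 1 := ht'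
      omega

theorem ncard_compl_conf [NeZero n] {y s : ZMod n} (hs : s = 1 ∨ s = -1) {g : Gaps}
    (hn : g.sum + 5 = n) : ((conf y s g)ᶜ).ncard = 5 := by
  classical
  have h : (conf y s g)ᶜ = ((({0, g.a + 1, g.a + g.b + 2, g.a + g.b + g.c + 3,
      g.a + g.b + g.c + g.d + 4} : Finset ℕ).image fun j : ℕ => y + s * (j : ZMod n) :
        Finset (ZMod n)) : Set (ZMod n)) := by
    ext x
    simp only [conf, Set.mem_compl_iff, Set.mem_ofPred_eq, not_and_or, not_not, Finset.coe_image,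
      Set.mem_image, Finset.mem_coe, Finset.mem_insert, Finset.mem_singleton, exists_eq_or_imp,
      exists_eq_left, Nat.cast_zero, mul_zero, add_zero, eq_comm (b := x)]
  simp only [Gaps.sum] at hn
  rw [h, Set.ncard_coe_finset, Finset.card_image_of_injOn]
  · rw [Finset.card_insert_of_notMem, Finset.card_insert_of_notMem,
      Finset.card_insert_of_notMem, Finset.card_insert_of_notMem, Finset.card_singleton]
    all_goals simp only [Finset.mem_insert, Finset.mem_singleton]; omega
  · intro i hi j hj hij
    simp only [Finset.coe_insert, Finset.coe_singleton, Set.mem_insert_iff,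
      Set.mem_singleton_iff] at hi hj
    exact add_mul_cast_inj hs (by omega) (by omega) hij

variable {k : ℕ}

theorem ncard_add_ncard_compl' [NeZero n] (C : Config n) : C.ncard + (Cᶜ).ncard = n := by
  rw [Set.ncard_add_ncard_compl, Nat.card_zmod]

theorem ncard_range {pos : Fin k → ZMod n} (h : Function.Injective pos) :
    (Set.range pos).ncard = k := by
  rw [← Set.image_univ, Set.ncard_image_of_injective _ h, Set.ncard_univ, Nat.card_fin]

theorem mem_range_update {pos : Fin k → ZMod n} (h : Function.Injective pos) (r : Fin k)
    (y x : ZMod n) : x ∈ Set.range (Function.update pos r y) ↔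
      x = y ∨ (x ∈ Set.range pos ∧ x ≠ pos r) := by
  constructor
  · rintro ⟨q, rfl⟩
    by_cases hq : q = r
    · subst hq; simp
    · right
      rw [Function.update_of_ne hq]
      exact ⟨⟨q, rfl⟩, fun h' => hq (h h')⟩
  · rintro (rfl | ⟨⟨q, rfl⟩, hq⟩)
    · exact ⟨r, by simp⟩
    · exact ⟨q, Function.update_of_ne (fun h' => hq (by rw [h'])) _ _⟩

theorem injective_update {pos : Fin k → ZMod n} (h : Function.Injective pos) {r : Fin k}
    {y : ZMod n} (hy : y ∉ Set.range pos) : Function.Injective (Function.update pos r y) := by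
  intro p q hpq
  by_cases hp : p = r <;> by_cases hq : q = r
  · rw [hp, hq]
  · subst hp
    rw [Function.update_self, Function.update_of_ne hq] at hpq
    exact absurd ⟨q, hpq.symm⟩ hy
  · subst hq
    rw [Function.update_self, Function.update_of_ne hp] at hpq
    exact absurd ⟨p, hpq⟩ hy
  · rw [Function.update_of_ne hp, Function.update_of_ne hq] at hpq
    exact h hpq

theorem range_update_eq_conf {pos : Fin k → ZMod n} (h : Function.Injective pos) {r : Fin k}
    {y s : ZMod n} (hs : s = 1 ∨ s = -1) {g : Gaps} (hn : g.sum + 5 = n) (ha : 1 ≤ g.a)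
    (hg : Set.range pos = conf y s g) (hr : pos r = y + s) :
    Set.range (Function.update pos r y) = conf (y + s) s g.mv := by
  ext x
  rw [mem_range_update h, mem_conf_mv hs hn ha, hg, hr]

theorem notMem_conf (y s : ZMod n) (g : Gaps) : y ∉ conf y s g := fun h => h.1 rfl

theorem decides_of_conf {m : ℕ} (hn : n = m + 8) {pos : Fin k → ZMod n}
    (h : Function.Injective pos) {g v : Gaps} (hg : g.sum = m + 3) (hv : Designated n m g v)
    {y s : ZMod n} (hs : s = 1 ∨ s = -1) (hc : Set.range pos = conf y s v) {r : Fin k}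
    (hr : pos r = y + s) : (algorithm n m).Decides pos r y := by
  have s1 := hv.1.sum_eq
  refine ⟨?_, ?_⟩
  · rw [hr]; rcases hs with rfl | rfl
    · right; ring
    · left; ring
  · rw [photoAt, photoAt, range_update_eq_conf h hs (by omega) hv.2.1.1 hc hr, hc, photo_conf hs,
      photo_conf hs, ← (gapPhoto_eq_iff (by omega) (by omega)).2 hv.1, hv.2.2.2.1]

/-- The algorithm prescribes only a photo; `UniqueMove` recovers from it the view in which the
deciding robot moves. -/
theorem conf_of_decides [NeZero n] {m : ℕ} (hn : n = m + 8) (hk : k = m + 3)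
    {pos : Fin k → ZMod n} (h : Function.Injective pos) {g v : Gaps} (hg : g.sum = m + 3)
    (hp : photoAt pos = gapPhoto n g) (hv : Designated n m g v) {r : Fin k} {y : ZMod n}
    (hd : (algorithm n m).Decides pos r y) :
    ∃ s : ZMod n, (s = 1 ∨ s = -1) ∧ pos r = y + s ∧ Set.range pos = conf y s v := by
  obtain ⟨hy, hA⟩ := hd
  have s1 := hv.1.sum_eq
  have s2 := Gaps.sum_mv hv.2.1.1
  rw [hp, hv.2.2.2.1, Option.some_inj, photoAt] at hA
  obtain ⟨y₁, d₁, hd₁, hc₁⟩ := exists_conf_of_photo_eq hA.symm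
  have hcard := ncard_compl_conf (y := y₁) hd₁ (show v.mv.sum + 5 = n by omega)
  rw [← hc₁] at hcard
  have hcard' := ncard_add_ncard_compl' (Set.range (Function.update pos r y))
  have hne : y ≠ pos r := by
    have h1 : (1 : ZMod n) ≠ 0 := by
      intro h1
      have := (ZMod.natCast_eq_zero_iff 1 n).1 (by simpa using h1)
      have := Nat.le_of_dvd one_pos this
      omega
    rintro h0
    rcases hy with hy | hy
    · exact h1 (by linear_combination h0 - hy)
    · exact h1 (by linear_combination hy - h0)
  -- Moving onto an occupied node would leave fewer than `k` occupied nodes, hence more than five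
  -- free ones.
  have hyr : y ∉ Set.range pos := by
    intro hmem
    have hsub : Set.range (Function.update pos r y) ⊆ Set.range pos \ {pos r} := by
      intro x hx
      rcases (mem_range_update h r y x).1 hx with rfl | hx
      · exact ⟨hmem, hne⟩
      · exact hx
    have h1 := Set.ncard_le_ncard hsub (Set.toFinite _)
    have h2 := Set.ncard_sdiff_singleton_lt_of_mem (s := Set.range pos) ⟨r, rfl⟩ (Set.toFinite _)
    have h3 := ncard_range h
    omega
  obtain ⟨s, hs, hr⟩ : ∃ s : ZMod n, (s = 1 ∨ s = -1) ∧ pos r = y + s := by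
    rcases hy with hy | hy
    · exact ⟨-1, .inr rfl, by rw [hy]; ring⟩
    · exact ⟨1, .inl rfl, by rw [hy]; ring⟩
  refine ⟨s, hs, hr, ?_⟩
  have h5 : ((Set.range pos)ᶜ).ncard = 5 := by
    have h1 := ncard_add_ncard_compl' (Set.range pos)
    have h2 := ncard_range h
    omega
  obtain ⟨g', hs', hg'⟩ := exists_conf h5 hyr hs
  have ha : 1 ≤ g'.a := by
    by_contra h0
    have h1 : pos r ∈ conf y s g' := hg' ▸ ⟨r, rfl⟩
    apply h1.2.1
    rw [hr, show g'.a = 0 by omega]; simp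
  have s3 := Gaps.sum_mv ha
  rw [range_update_eq_conf h hs hs' ha hg' hr, photo_conf hs,
    gapPhoto_eq_iff (by omega) (by omega)] at hA
  rw [photoAt, hg', photo_conf hs, gapPhoto_eq_iff (by omega) (by omega)] at hp
  rw [hg', hv.2.1.2.1 g' (hv.1.symm.trans hp.symm) ha hA]

end
end RingRobots

/-! ### Compatibility of simultaneous decisions -/

namespace RingRobots
section
variable {n k : ℕ}

/-- Distinct robots, not equally distributed. -/
def Regular (pos : Fin k → ZMod n) : Prop :=
  Function.Injective pos ∧ ∃ g : Gaps, g.sum + 5 = n ∧ ¬ g.Const ∧ photoAt pos = gapPhoto n g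

theorem mirror_of_conf_eq {y y' s : ZMod n} (hs : s = 1 ∨ s = -1) {v : Gaps}
    (hn : v.sum + 5 = n) (h : conf y s v = conf y' (-s) v) : v.Mirror := by
  obtain ⟨a, b, c, d, e⟩ := v
  rw [conf_flip y s hn] at h
  have h1 := eq_of_conf_eq (neg_dir hs) (by simp only [Gaps.sum] at *; omega) hn h
  simp only [Gaps.mk.injEq] at h1
  simp only [Gaps.Mirror]
  omega

/-- When a symmetric configuration with gaps `v` is seen the same way in both directions, the gaps
seen from the second free node after the move at the first one. -/
theorem restoreMove_of_mirrorMove {y y' s : ZMod n} (hs : s = 1 ∨ s = -1) {v : Gaps}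
    (hn : v.sum + 5 = n) (hodd : v.sum % 2 = 1) (hc : ¬ v.Const) (hv : v.MirrorMove)
    (h : conf y s v = conf y' (-s) v) (hne : y + s ≠ y' + -s) :
    ∃ w : Gaps, w.RestoreMove ∧ v.mv.Sim w ∧ conf (y + s) s v.mv = conf y' (-s) w := by
  obtain ⟨a, b, c, d, e⟩ := v
  have swap : ∀ z, conf y s ⟨a, b, c, d, e⟩ = conf z (-s) ⟨a, b, c, d, e⟩ → y' = z :=
    fun z hz => node_unique (neg_dir hs) hn hc (hz.symm.trans h)
  have e2 : 1 ≤ a → y + s + s * ((a - 1 + 1 : ℕ) : ZMod n) = y + s * ((a + 1 : ℕ) : ZMod n) := by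
    intro h
    rw [Nat.sub_add_cancel h]; push_cast; ring
  simp only [Gaps.sum] at hodd
  have hn' : a + b + c + d + e + 5 = n := hn
  rcases hv with ⟨h1, h2, h3, h4⟩ | ⟨h1, h2, h3, h4, h5⟩ | ⟨h1, h2, h3, h4, h5, h6⟩ <;>
  simp only at h1 h2 h3 h4
  · subst h2 h3
    obtain rfl := swap _ ((conf_rot y s hn).trans
      (conf_flip _ s (by simp only [Gaps.sum]; omega)))
    -- A single robot on the axis has two possible targets but no twin. By parity `a ≥ 3` remains,
    -- as `RestoreMove` needs after the move.
    have h5 : a ≠ 1 := by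
      rintro rfl
      apply hne
      push_cast; ring
    refine ⟨⟨a - 1, b + 1, c, c, b⟩, ?_, by simp [Gaps.Sim, Gaps.views, Gaps.mv], ?_⟩
    · simp only [Gaps.RestoreMove, true_and]; omega
    · refine (conf_rot _ s (by simp only [Gaps.sum]; omega)).trans
        ((conf_flip _ s (by simp only [Gaps.sum]; omega)).trans ?_)
      rw [e2 h1]
  · subst h1 h2
    simp only at h5
    obtain rfl := swap _ ((conf_rot y s hn).trans
      ((conf_rot _ s (by simp only [Gaps.sum]; omega)).trans
      ((conf_rot _ s (by simp only [Gaps.sum]; omega)).trans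
      (conf_flip _ s (by simp only [Gaps.sum]; omega)))))
    refine ⟨⟨c, b, c - 1, d + 1, d⟩, ?_, by simp [Gaps.Sim, Gaps.views, Gaps.mv], ?_⟩
    · simp only [Gaps.RestoreMove, true_and]; omega
    · refine (conf_rot _ s (by simp only [Gaps.sum]; omega)).trans
        ((conf_rot _ s (by simp only [Gaps.sum]; omega)).trans
        ((conf_rot _ s (by simp only [Gaps.sum]; omega)).trans
        ((conf_flip _ s (by simp only [Gaps.sum]; omega)).trans ?_)))
      rw [e2 h4]
  · subst h2 h3 h4
    simp only at h5 h6
    obtain rfl := swap _ ((conf_rot y s hn).trans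
      ((conf_rot _ s (by simp only [Gaps.sum]; omega)).trans
      (conf_flip _ s (by simp only [Gaps.sum]; omega))))
    refine ⟨⟨e, e - 1, e + 1, d, e⟩, ?_, by simp [Gaps.Sim, Gaps.views, Gaps.mv], ?_⟩
    · simp only [Gaps.RestoreMove, true_and]; omega
    · refine (conf_rot _ s (by simp only [Gaps.sum]; omega)).trans
        ((conf_rot _ s (by simp only [Gaps.sum]; omega)).trans
        ((conf_flip _ s (by simp only [Gaps.sum]; omega)).trans ?_))
      rw [e2 h1]

/-- The parameters of the ring: `m + 3` robots on `m + 8` nodes, where `m` is even. -/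
structure Params (n k m : ℕ) : Prop where
  four_le : 4 ≤ m
  even : m % 2 = 0
  n_eq : n = m + 8
  k_eq : k = m + 3

variable {m : ℕ}

theorem Regular.exists_designated (P : Params n k m) {pos : Fin k → ZMod n} (h : Regular pos) :
    ∃ g v : Gaps, g.sum = m + 3 ∧ ¬ g.Const ∧ photoAt pos = gapPhoto n g ∧
      Designated n m g v := by
  obtain ⟨-, g, hs, hc, hp⟩ := h
  have hn := P.n_eq
  obtain ⟨v, hv⟩ := RingRobots.exists_designated P.four_le P.even P.n_eq
    (show g.sum = m + 3 by omega) hc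
  exact ⟨g, v, by omega, hc, hp, hv⟩

theorem Regular.exists_decides (P : Params n k m) {pos : Fin k → ZMod n} (h : Regular pos) :
    ∃ r y, (algorithm n m).Decides pos r y := by
  obtain ⟨g, v, hs, hc, hp, hv⟩ := h.exists_designated P
  have hn := P.n_eq
  have s1 := hv.1.sum_eq
  rw [(gapPhoto_eq_iff (by omega) (by omega)).2 hv.1] at hp
  obtain ⟨y, s, hd, hr⟩ := exists_conf_of_photo_eq hp
  have hmem : y + s ∈ Set.range pos := by
    have := mem_conf_iff (y := y) hd (show v.sum + 5 = n by omega) (show 1 < n by omega)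
    have ha := hv.2.1.1
    rw [hr]
    rw [Nat.cast_one, mul_one] at this
    rw [this]
    omega
  obtain ⟨r, hr'⟩ := hmem
  exact ⟨r, y, decides_of_conf hn h.1 hs hv hd hr hr'⟩

theorem Regular.update [NeZero n] (P : Params n k m) {pos : Fin k → ZMod n} (h : Regular pos)
    {r : Fin k} {y : ZMod n} (hd : (algorithm n m).Decides pos r y) :
    y ∉ Set.range pos ∧ Regular (Function.update pos r y) ∧
      (rank m (photoAt (Function.update pos r y)) < rank m (photoAt pos) ∨
        rank m (photoAt (Function.update pos r y)) = 0) := by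
  obtain ⟨g, v, hs, hc, hp, hv⟩ := h.exists_designated P
  have hn := P.n_eq
  have s1 := hv.1.sum_eq
  have s2 := Gaps.sum_mv hv.2.1.1
  obtain ⟨s, hs', hr, hC⟩ := conf_of_decides hn P.k_eq h.1 hs hp hv hd
  have hy : y ∉ Set.range pos := hC ▸ notMem_conf y s v
  have hph : photoAt (Function.update pos r y) = gapPhoto n v.mv := by
    rw [photoAt, range_update_eq_conf h.1 hs' (by omega) hv.2.1.1 hC hr, photo_conf hs']
  refine ⟨hy, ⟨injective_update h.1 hy, v.mv, by omega, hv.2.2.1, hph⟩, ?_⟩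
  rw [hph, hp]
  exact hv.2.2.2.2

/-- Two different robots can decide only in a symmetric configuration, as mirror images. Once one
has moved, the move of the other is a `RestoreMove`, and the algorithm must prescribe it. -/
theorem Regular.decides_update [NeZero n] (P : Params n k m) {pos : Fin k → ZMod n}
    (h : Regular pos) {r r' : Fin k} {y y' : ZMod n} (hd : (algorithm n m).Decides pos r y)
    (hd' : (algorithm n m).Decides pos r' y') (hne : r ≠ r') :
    (algorithm n m).Decides (Function.update pos r y) r' y' := by
  obtain ⟨g, v, hs, hc, hp, hv⟩ := h.exists_designated P
  have hn := P.n_eq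
  have hev := P.even
  have hm4 := P.four_le
  have s1 := hv.1.sum_eq
  have s2 := Gaps.sum_mv hv.2.1.1
  have hcv : ¬ v.Const := fun h => hc (hv.1.symm.const h)
  obtain ⟨s, hs₁, hr, hC⟩ := conf_of_decides hn P.k_eq h.1 hs hp hv hd
  obtain ⟨s', hs₂, hr', hC'⟩ := conf_of_decides hn P.k_eq h.1 hs hp hv hd'
  have hCC := hC.symm.trans hC'
  have hpos : pos r ≠ pos r' := fun h' => hne (h.1 h')
  -- Equal directions give the same free node and hence the same robot; opposite directions give a
  -- reflection.
  obtain rfl | rfl := eq_or_eq_neg hs₁ hs₂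
  · obtain rfl := node_unique hs₁ (by omega) hcv hCC
    exact absurd (hr.trans hr'.symm) hpos
  have hmir := hv.2.1.2.2.1 (mirror_of_conf_eq hs₁ (by omega) hCC)
  obtain ⟨w, hw, hvw, hCw⟩ := restoreMove_of_mirrorMove hs₁ (by omega) (by omega) hcv hmir hCC
    (by rwa [hr, hr'] at hpos)
  have s3 := hvw.sum_eq
  have hC₁ := range_update_eq_conf h.1 hs₁ (by omega) hv.2.1.1 hC hr
  obtain ⟨u, hu⟩ := RingRobots.exists_designated hm4 hev hn (show w.sum = m + 3 by omega)
    (fun h => hv.2.2.1 (hvw.symm.const h))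
  have s4 := hu.1.sum_eq
  -- The view chosen by the algorithm is restorable, so `Edge` makes it a `RestoreMove`; uniqueness
  -- identifies it with the pending one.
  obtain rfl : u = w := hw.unique (by omega) (by omega) hu.1
    (hu.2.1.2.2.2 ⟨w, hu.1.symm, hw⟩)
  refine decides_of_conf hn (injective_update h.1 (hC ▸ notMem_conf y s v)) (by omega) hu
    hs₂ (hC₁.trans hCw) ?_
  rw [Function.update_of_ne hne.symm, hr']

end
end RingRobots

/-! ### Photos of the cycle and initial configurations -/

namespace RingRobots
section
variable {n k m : ℕ}

theorem mem_conf_natCast [NeZero n] {y : ℕ} {g : Gaps} (h : y + g.a + g.b + g.c + g.d + 4 < n)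
    (x : ZMod n) : x ∈ conf (y : ZMod n) 1 g ↔
      x.val ≠ y ∧ x.val ≠ y + g.a + 1 ∧ x.val ≠ y + g.a + g.b + 2 ∧
        x.val ≠ y + g.a + g.b + g.c + 3 ∧ x.val ≠ y + g.a + g.b + g.c + g.d + 4 := by
  have key : ∀ j : ℕ, j < n → (x ≠ (j : ZMod n) ↔ x.val ≠ j) := by
    intro j hj
    refine not_congr ⟨fun h => by rw [h, ZMod.val_cast_of_lt hj], fun h => ?_⟩
    rw [← h, ZMod.natCast_zmod_val]
  simp only [conf, Set.mem_ofPred_eq, one_mul, ← Nat.cast_add]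
  rw [key _ (by omega), key _ (by omega), key _ (by omega), key _ (by omega), key _ (by omega)]
  simp only [add_assoc]

theorem blocks_eq [NeZero n] {L : List (ℕ × ℕ)} {y : ℕ} {g g' : Gaps} (hg : g.sum + 5 = n)
    (hy : y + g.a + g.b + g.c + g.d + 4 < n) (hs : g.Sim g')
    (h : ∀ j < n, (blockWord L)[j]? = some true ↔ j ≠ y ∧ j ≠ y + g.a + 1 ∧
      j ≠ y + g.a + g.b + 2 ∧ j ≠ y + g.a + g.b + g.c + 3 ∧
        j ≠ y + g.a + g.b + g.c + g.d + 4) : blocks n L = gapPhoto n g' := by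
  rw [← (gapPhoto_eq_iff hg (by rw [hs.sum_eq, hg])).2 hs, ← photo_conf (y := (y : ZMod n)) (.inl rfl),
    blocks]
  congr 1
  ext x
  rw [mem_conf_natCast hy, Set.mem_ofPred_eq, h _ (ZMod.val_lt x)]

theorem permanentPhoto_eq [NeZero n] (P : Params n k m) (i : Fin 5) :
    permanentPhoto n i = gapPhoto n (Gaps.perm m i) := by
  have hn := P.n_eq
  obtain ⟨h7, h8⟩ : n - 7 = m + 1 ∧ n - 8 = m := by omega
  have word : ∀ (L : List Bool) (l j : ℕ) (b : Bool),
      (List.replicate l b ++ L)[j]? = if j < l then some b else L[j - l]? := by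
    intro L l j b
    rw [List.getElem?_append, List.length_replicate]
    split_ifs with h
    · rw [List.getElem?_replicate, if_pos h]
    · rfl
  fin_cases i
  · refine blocks_eq (y := 2) (g := ⟨0, m + 1, 0, 0, 2⟩) ?_ ?_ ?_ ?_
    · simp [Gaps.sum]; omega
    · simp; omega
    · simp [Gaps.Sim, Gaps.views, Gaps.perm]
    · intro j hj
      simp only [blockWord, h7, List.flatMap_cons, List.flatMap_nil, List.append_assoc, word,
        List.getElem?_nil]
      split_ifs <;> simp <;> omega
  · refine blocks_eq (y := 2) (g := ⟨0, m, 1, 0, 2⟩) ?_ ?_ ?_ ?_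
    · simp [Gaps.sum]; omega
    · simp; omega
    · simp [Gaps.Sim, Gaps.views, Gaps.perm]
    · intro j hj
      simp only [blockWord, h8, List.flatMap_cons, List.flatMap_nil, List.append_assoc, word,
        List.getElem?_nil]
      split_ifs <;> simp <;> omega
  · refine blocks_eq (y := 2) (g := ⟨0, m, 0, 1, 2⟩) ?_ ?_ ?_ ?_
    · simp [Gaps.sum]; omega
    · simp; omega
    · simp [Gaps.Sim, Gaps.views, Gaps.perm]
    · intro j hj
      simp only [blockWord, h8, List.flatMap_cons, List.flatMap_nil, List.append_assoc, word,
        List.getElem?_nil]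
      split_ifs <;> simp <;> omega
  · refine blocks_eq (y := 3) (g := ⟨0, m, 0, 0, 3⟩) ?_ ?_ ?_ ?_
    · simp [Gaps.sum]; omega
    · simp; omega
    · simp [Gaps.Sim, Gaps.views, Gaps.perm]
    · intro j hj
      simp only [blockWord, h8, List.flatMap_cons, List.flatMap_nil, List.append_assoc, word,
        List.getElem?_nil]
      split_ifs <;> simp <;> omega
  · refine blocks_eq (y := 2) (g := ⟨1, m, 0, 0, 2⟩) ?_ ?_ ?_ ?_
    · simp [Gaps.sum]; omega
    · simp; omega
    · simp [Gaps.Sim, Gaps.views, Gaps.perm]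
    · intro j hj
      simp only [blockWord, h8, List.flatMap_cons, List.flatMap_nil, List.append_assoc, word,
        List.getElem?_nil]
      split_ifs <;> simp <;> omega

/-- Equal gaps `a` would make 5 a common divisor of `n` and `k`, and the rotation by `a + 1` a
symmetry. -/
theorem Regular.of_init [NeZero n] (P : Params n k m) {init : Fin k → ZMod n}
    (hinj : Function.Injective init) (h : Nat.Coprime n k ∨ Aperiodic init) : Regular init := by
  have hn := P.n_eq
  have hk := P.k_eq
  have h5 : ((Set.range init)ᶜ).ncard = 5 := by
    have h1 := ncard_add_ncard_compl' (Set.range init)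
    have h2 := ncard_range hinj
    omega
  obtain ⟨y, hy⟩ : ((Set.range init)ᶜ).Nonempty := by
    apply Set.nonempty_of_ncard_ne_zero; omega
  obtain ⟨g, hs, hg⟩ := exists_conf (s := 1) h5 hy (.inl rfl)
  refine ⟨hinj, g, hs, ?_, by rw [photoAt, hg, photo_conf (.inl rfl)]⟩
  obtain ⟨a, b, c, d, e⟩ := g
  rintro ⟨h1, h2, h3, h4⟩
  simp only at h1 h2 h3 h4
  subst h1 h2 h3 h4
  have hs' : a + a + a + a + a + 5 = n := hs
  rcases h with h | h
  · have h5n : 5 ∣ n := ⟨a + 1, by omega⟩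
    have h5k : 5 ∣ k := ⟨a, by omega⟩
    have := Nat.dvd_gcd h5n h5k
    rw [h] at this
    omega
  · have hrot := conf_rot y 1 hs
    have key := h (1 * ((a + 1 : ℕ) : ZMod n)) (fun x => by
      rw [hg]
      conv_rhs => rw [hrot]
      simp only [conf, Set.mem_ofPred_eq, ne_eq, add_right_comm _ (1 * ((a + 1 : ℕ) : ZMod n)),
        add_left_inj])
    rw [one_mul, ZMod.natCast_eq_zero_iff] at key
    have := Nat.le_of_dvd (by omega) key
    omega

end
end RingRobots

/-! ### Asynchronous steps preserve the invariant -/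

namespace RingRobots
section
variable {n k m : ℕ}

/-- The robots of `M` carry out moves that they could also decide on now. -/
theorem Regular.piecewise [NeZero n] (P : Params n k m) {pos Y : Fin k → ZMod n} (h : Regular pos)
    (M : Finset (Fin k)) (hM : ∀ r ∈ M, (algorithm n m).Decides pos r (Y r)) :
    Regular (M.piecewise Y pos) ∧
      (∀ r ∉ M, ∀ y, (algorithm n m).Decides pos r y →
        (algorithm n m).Decides (M.piecewise Y pos) r y) ∧
      (M = ∅ ∨ rank m (photoAt (M.piecewise Y pos)) < rank m (photoAt pos) ∨
        rank m (photoAt (M.piecewise Y pos)) = 0) := by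
  induction M using Finset.induction_on with
  | empty => exact ⟨by simpa using h, by simp, .inl rfl⟩
  | insert r M hr ih =>
    obtain ⟨h1, h2, h3⟩ := ih fun q hq => hM q (Finset.mem_insert_of_mem hq)
    have hd := h2 r hr _ (hM r (Finset.mem_insert_self r M))
    obtain ⟨-, h4, h5⟩ := h1.update P hd
    rw [Finset.piecewise_insert]
    refine ⟨h4, fun q hq y hy => ?_, .inr ?_⟩
    · rw [Finset.mem_insert, not_or] at hq
      exact h1.decides_update P hd (h2 q hq.2 y hy) (Ne.symm hq.1)
    · rcases h3 with rfl | h3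
      · simpa using h5
      · omega

/-- The robots are distinct, and every pending move could also be decided on now. -/
def Valid (m : ℕ) (s : State n k) : Prop :=
  Regular s.pos ∧ ∀ r y, s.plan r = some y → (algorithm n m).Decides s.pos r y

/-- The number of robots without a pending move. -/
def idleCount (s : State n k) : ℕ := (Finset.univ.filter fun r => s.plan r = none).card

/-- `M` consists of the activated robots with a pending move. If there are none, some idle robot
acquires a plan and none loses one, so `idleCount` drops. -/
theorem Valid.exists_movers [NeZero n] (P : Params n k m) {s s' : State n k} (h : Valid m s)
    (hs : Step (algorithm n m) s s') :
    ∃ M : Finset (Fin k), (∀ r ∈ M, (algorithm n m).Decides s.pos r (s'.pos r)) ∧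
      (∀ r ∉ M, s'.pos r = s.pos r) ∧ (M = ∅ → idleCount s' < idleCount s) ∧
      ∀ r y, s'.plan r = some y → r ∉ M ∧ (algorithm n m).Decides s.pos r y := by
  classical
  rcases hs with ⟨T, ⟨q, hq⟩, hT, hT'⟩ | ⟨hno, -⟩
  · refine ⟨Finset.univ.filter fun r => r ∈ T ∧ s.plan r ≠ none, ?_, ?_, ?_, ?_⟩
    · intro r hr
      simp only [Finset.mem_filter, Finset.mem_univ, true_and] at hr
      rcases hT r hr.1 with h' | ⟨y, hy, hp, -⟩
      · exact absurd h'.1 hr.2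
      · rw [hp]; exact h.2 r y hy
    · intro r hr
      simp only [Finset.mem_filter, Finset.mem_univ, true_and, not_and, not_not] at hr
      by_cases hrT : r ∈ T
      · rcases hT r hrT with ⟨-, y, -, hp, -⟩ | ⟨y, hy, -⟩
        · exact hp
        · rw [hr hrT] at hy; cases hy
      · exact (hT' r hrT).1
    · intro hM
      have hidle : ∀ r ∈ T, s.plan r = none := by
        intro r hr
        by_contra hne
        exact Finset.notMem_empty r (hM ▸ Finset.mem_filter.2 ⟨Finset.mem_univ r, hr, hne⟩)
      have hplan : ∀ r ∈ T, s'.plan r ≠ none := by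
        intro r hr
        rcases hT r hr with ⟨-, y, -, -, hp⟩ | ⟨y, hy, -⟩
        · simp [hp]
        · rw [hidle r hr] at hy; cases hy
      refine Finset.card_lt_card (Finset.ssubset_iff_of_subset ?_ |>.2 ⟨q, ?_, ?_⟩)
      · intro r hr
        simp only [Finset.mem_filter, Finset.mem_univ, true_and] at hr ⊢
        by_cases hrT : r ∈ T
        · exact hidle r hrT
        · rw [← (hT' r hrT).2, hr]
      · simp [hidle q hq]
      · simp [hplan q hq]
    · intro r y hr
      by_cases hrT : r ∈ T
      · rcases hT r hrT with ⟨hn, z, hd, -, hp⟩ | ⟨z, hz, -, hp⟩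
        · rw [hp, Option.some_inj] at hr
          exact ⟨by simp [hn], hr ▸ hd⟩
        · rw [hp] at hr; cases hr
      · rw [(hT' r hrT).2] at hr
        exact ⟨by simp [hrT], h.2 r y hr⟩
  -- The algorithm never stops on regular positions, so some robot is activable.
  · obtain ⟨r, y, hd⟩ := h.1.exists_decides P
    exfalso
    apply hno r
    cases hr : s.plan r with
    | none => exact .inr ⟨hr, y, hd⟩
    | some z => exact .inl ⟨z, hr⟩

theorem Valid.step [NeZero n] (P : Params n k m) {s s' : State n k} (h : Valid m s)
    (hs : Step (algorithm n m) s s') :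
    Valid m s' ∧ ∃ M : Finset (Fin k), (∀ r ∈ M, (algorithm n m).Decides s.pos r (s'.pos r)) ∧
      (∀ r ∉ M, s'.pos r = s.pos r) ∧ (M = ∅ → idleCount s' < idleCount s) ∧
      (M = ∅ ∨ rank m (photoAt s'.pos) < rank m (photoAt s.pos) ∨
        rank m (photoAt s'.pos) = 0) := by
  obtain ⟨M, h1, h2, h3, h4⟩ := h.exists_movers P hs
  have hpos : s'.pos = M.piecewise s'.pos s.pos := by
    funext r
    by_cases hr : r ∈ M
    · simp [hr]
    · simp [hr, h2 r hr]
  obtain ⟨k1, k2, k3⟩ := h.1.piecewise P M h1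
  rw [← hpos] at k1 k2 k3
  exact ⟨⟨k1, fun r y hr => k2 r (h4 r y hr).1 y (h4 r y hr).2⟩, M, h1, h2, h3, k3⟩

theorem conf_mv_perm (P : Params n k m) (y d : ZMod n) (i : Fin 5) :
    conf (y + d) d (Gaps.perm m i).mv =
      conf (y - d * ((Gaps.perm m (i + 1)).a : ZMod n)) d (Gaps.perm m (i + 1)) := by
  have hn := P.n_eq
  have s1 := Gaps.sum_perm m (i + 1)
  have e : y - d * ((Gaps.perm m (i + 1)).a : ZMod n) +
      d * (((Gaps.perm m (i + 1)).a + 1 : ℕ) : ZMod n) = y + d := by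
    push_cast; ring
  rw [Gaps.mv_perm, ← e]
  exact (conf_rot _ d (by change (Gaps.perm m (i + 1)).sum + 5 = n; omega)).symm

/-- In the permanent regime only one robot can decide to move. -/
theorem decides_perm [NeZero n] (P : Params n k m) {pos : Fin k → ZMod n}
    (h : Function.Injective pos) {y d : ZMod n} (hd : d = 1 ∨ d = -1) {i : Fin 5}
    (hp : Set.range pos = conf y d (Gaps.perm m i)) {r : Fin k} {z : ZMod n}
    (hr : (algorithm n m).Decides pos r z) : z = y ∧ pos r = y + d := by
  have hn := P.n_eq
  have s1 := Gaps.sum_perm m i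
  have hmir := Gaps.not_mirror_perm P.four_le i
  have hph : photoAt pos = gapPhoto n (Gaps.perm m i) := by rw [photoAt, hp, photo_conf hd]
  obtain ⟨d', hd', hr', hc⟩ := conf_of_decides hn P.k_eq h s1 hph
    (designated_of_sim_perm P.four_le P.even hn (.refl _)) hr
  have hcc := hp.symm.trans hc
  obtain rfl | rfl := eq_or_eq_neg hd hd'
  · obtain rfl := node_unique hd (by omega) (Gaps.not_const_of_not_mirror hmir) hcc
    exact ⟨rfl, hr'⟩
  · exact absurd (mirror_of_conf_eq hd (by omega) hcc) hmir

theorem Valid.step_perm [NeZero n] (P : Params n k m) {s s' : State n k} (h : Valid m s)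
    (hs : Step (algorithm n m) s s') {y d : ZMod n} (hd : d = 1 ∨ d = -1) {i : Fin 5}
    (hp : Set.range s.pos = conf y d (Gaps.perm m i)) :
    (s'.pos = s.pos ∧ idleCount s' < idleCount s) ∨
      ((∀ r, s'.pos r = s.pos r ∨ s'.pos r = s.pos r - d) ∧
        Set.range s'.pos =
          conf (y - d * ((Gaps.perm m (i + 1)).a : ZMod n)) d (Gaps.perm m (i + 1))) := by
  have hn := P.n_eq
  have s1 := Gaps.sum_perm m i
  obtain ⟨-, M, h1, h2, h3, -⟩ := h.step P hs
  rcases M.eq_empty_or_nonempty with rfl | ⟨q, hq⟩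
  · exact .inl ⟨funext fun r => h2 r (Finset.notMem_empty r), h3 rfl⟩
  · right
    have key := fun r hr => decides_perm P h.1.1 hd hp (h1 r hr)
    refine ⟨fun r => ?_, ?_⟩
    · by_cases hr : r ∈ M
      · right
        rw [(key r hr).1, (key r hr).2]; ring
      · exact .inl (h2 r hr)
    · have hpos : s'.pos = Function.update s.pos q y := by
        funext r
        by_cases hrq : r = q
        · subst hrq
          rw [Function.update_self, (key r hq).1]
        · rw [Function.update_of_ne hrq]
          exact h2 r fun hr => hrq (h.1.1 ((key r hr).2.trans (key q hq).2.symm))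
      rw [hpos, range_update_eq_conf h.1.1 hd (by omega) (Gaps.one_le_perm_a m i) hp (key q hq).2,
        conf_mv_perm P]

end
end RingRobots

/-! ### Executions: convergence, safety, exploration -/

namespace RingRobots
section
variable {n k m : ℕ} {s : ℕ → State n k}

theorem valid_execution [NeZero n] (P : Params n k m) {init : Fin k → ZMod n}
    (hr : Regular init) (hs : IsExecution (algorithm n m) init s) (t : ℕ) : Valid m (s t) := by
  induction t with
  | zero =>
    refine ⟨hs.pos_zero.symm ▸ hr, fun r y hy => ?_⟩
    rw [hs.plan_zero r] at hy
    cases hy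
  | succ t ih => exact (ih.step P (hs.step t)).1

/-- Injectivity is part of the invariant, and the target of a move is free before the step, which
rules out crossings. -/
theorem collisionFree [NeZero n] (P : Params n k m) (hv : ∀ t, Valid m (s t))
    (hs : ∀ t, Step (algorithm n m) (s t) (s (t + 1))) : CollisionFree s := by
  intro t r q hrq
  refine ⟨fun h => hrq ((hv t).1.1 h), ?_⟩
  rintro ⟨h1, h2⟩
  obtain ⟨-, M, h3, h4, -⟩ := (hv t).step P (hs t)
  by_cases hr : r ∈ M
  · exact ((hv t).1.update P (h3 r hr)).1 ⟨q, h1.symm⟩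
  · exact hrq ((hv t).1.1 ((h4 r hr).symm.trans h1))

theorem rank_step [NeZero n] (P : Params n k m) (hv : ∀ t, Valid m (s t))
    (hs : ∀ t, Step (algorithm n m) (s t) (s (t + 1))) (t : ℕ) :
    rank m (photoAt (s (t + 1)).pos) = 0 ∨
      rank m (photoAt (s (t + 1)).pos) < rank m (photoAt (s t).pos) ∨
        ((s (t + 1)).pos = (s t).pos ∧ idleCount (s (t + 1)) < idleCount (s t)) := by
  obtain ⟨-, M, -, h2, h3, h4⟩ := (hv t).step P (hs t)
  rcases h4 with rfl | h4 | h4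
  · exact .inr (.inr ⟨funext fun r => h2 r (Finset.notMem_empty r), h3 rfl⟩)
  · exact .inr (.inl h4)
  · exact .inl h4

/-- Lexicographic descent on the rank and the number of idle robots. Rank 0 is never left. -/
theorem exists_rank_eq_zero [NeZero n] (P : Params n k m) (hv : ∀ t, Valid m (s t))
    (hs : ∀ t, Step (algorithm n m) (s t) (s (t + 1))) :
    ∃ t₀, ∀ t ≥ t₀, rank m (photoAt (s t).pos) = 0 := by
  have key : ∀ a b t, rank m (photoAt (s t).pos) = a → idleCount (s t) = b →
      ∃ t₀, rank m (photoAt (s t₀).pos) = 0 := by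
    intro a
    induction a using Nat.strong_induction_on with
    | _ a iha =>
      intro b
      induction b using Nat.strong_induction_on with
      | _ b ihb =>
        intro t ha hb
        rcases rank_step P hv hs t with h | h | ⟨h, h'⟩
        · exact ⟨_, h⟩
        · exact iha _ (ha ▸ h) _ (t + 1) rfl rfl
        · exact ihb _ (hb ▸ h') (t + 1) (by rw [h, ha]) rfl
  obtain ⟨t₀, ht₀⟩ := key _ _ 0 rfl rfl
  refine ⟨t₀, fun t ht => ?_⟩
  induction t, ht using Nat.le_induction with
  | base => exact ht₀
  | succ t _ ih =>
    rcases rank_step P hv hs t with h | h | ⟨h, -⟩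
    · exact h
    · omega
    · rw [h, ih]

theorem exists_perm_of_rank [NeZero n] (P : Params n k m) {t : ℕ} (hv : Valid m (s t))
    (h : rank m (photoAt (s t).pos) = 0) :
    ∃ i, photoAt (s t).pos = gapPhoto n (Gaps.perm m i) := by
  have hn := P.n_eq
  obtain ⟨-, g, hs, hc, hp⟩ := hv.1
  rw [hp] at h ⊢
  exact exists_perm_of_rank_eq_zero P.four_le P.even hn (by omega) hc h

/-- In the permanent regime the next photo is reached eventually. -/
theorem exists_next [NeZero n] (P : Params n k m) (hv : ∀ t, Valid m (s t))
    (hs : ∀ t, Step (algorithm n m) (s t) (s (t + 1))) {d : ZMod n} (hd : d = 1 ∨ d = -1)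
    {t : ℕ} {y : ZMod n} {i : Fin 5} (hp : Set.range (s t).pos = conf y d (Gaps.perm m i)) :
    ∃ t' > t, Set.range (s t').pos =
      conf (y - d * ((Gaps.perm m (i + 1)).a : ZMod n)) d (Gaps.perm m (i + 1)) := by
  have key : ∀ b t, idleCount (s t) = b → Set.range (s t).pos = conf y d (Gaps.perm m i) →
      ∃ t' > t, Set.range (s t').pos =
        conf (y - d * ((Gaps.perm m (i + 1)).a : ZMod n)) d (Gaps.perm m (i + 1)) := by
    intro b
    induction b using Nat.strong_induction_on with
    | _ b ih =>
      intro t hb hp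
      rcases (hv t).step_perm P (hs t) hd hp with ⟨h1, h2⟩ | ⟨-, h⟩
      · obtain ⟨t', ht', h'⟩ := ih _ (hb ▸ h2) (t + 1) rfl (by rw [h1, hp])
        exact ⟨t', by omega, h'⟩
      · exact ⟨t + 1, by omega, h⟩
  exact key _ t rfl hp

theorem exists_round [NeZero n] (P : Params n k m) (hv : ∀ t, Valid m (s t))
    (hs : ∀ t, Step (algorithm n m) (s t) (s (t + 1))) {d : ZMod n} (hd : d = 1 ∨ d = -1)
    {t : ℕ} {y : ZMod n} (hp : Set.range (s t).pos = conf y d (Gaps.perm m 0)) :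
    ∃ t' > t, Set.range (s t').pos = conf (y + d) d (Gaps.perm m 0) := by
  obtain ⟨t₁, l₁, h₁⟩ := exists_next P hv hs hd hp
  obtain ⟨t₂, l₂, h₂⟩ := exists_next P hv hs hd h₁
  obtain ⟨t₃, l₃, h₃⟩ := exists_next P hv hs hd h₂
  obtain ⟨t₄, l₄, h₄⟩ := exists_next P hv hs hd h₃
  obtain ⟨t₅, l₅, h₅⟩ := exists_next P hv hs hd h₄
  refine ⟨t₅, by omega, h₅.trans ?_⟩
  have h8 : (m : ZMod n) + 8 = 0 := by
    have := congrArg (Nat.cast : ℕ → ZMod n) P.n_eq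
    push_cast at this
    rw [← this, ZMod.natCast_self]
  -- The five shifts add up to `m + 7`, which is `-1` modulo `n = m + 8`.
  change conf (y - d * ((1 : ℕ) : ZMod n) - d * ((1 : ℕ) : ZMod n) - d * ((3 : ℕ) : ZMod n) -
    d * ((1 : ℕ) : ZMod n) - d * ((m + 1 : ℕ) : ZMod n)) d (Gaps.perm m 0) = _
  congr 1
  push_cast
  linear_combination -d * h8

/-- Each round moves the reference free node by `d`, so it sweeps the whole ring. -/
theorem exists_free [NeZero n] (P : Params n k m) (hv : ∀ t, Valid m (s t))
    (hs : ∀ t, Step (algorithm n m) (s t) (s (t + 1))) {d : ZMod n} (hd : d = 1 ∨ d = -1)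
    {t : ℕ} {y : ZMod n} {i : Fin 5} (hp : Set.range (s t).pos = conf y d (Gaps.perm m i))
    (x : ZMod n) : ∃ t' > t, x ∉ Set.range (s t').pos := by
  have many : ∀ c : ℕ, ∃ t' ≥ t, ∃ y', Set.range (s t').pos = conf y' d (Gaps.perm m (i + c • 1)) := by
    intro c
    induction c with
    | zero => exact ⟨t, le_rfl, y, by simpa using hp⟩
    | succ c ih =>
      obtain ⟨t₁, l₁, y₁, h₁⟩ := ih
      obtain ⟨t₂, l₂, h₂⟩ := exists_next P hv hs hd h₁
      refine ⟨t₂, by omega, y₁ - d * ((Gaps.perm m (i + c • 1 + 1)).a : ZMod n), ?_⟩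
      rw [succ_nsmul, ← add_assoc]
      exact h₂
  -- From photo `i`, `-i` further transitions lead to photo 0, where whole rounds can be counted.
  have zero : ∀ i : Fin 5, i + (-i).val • 1 = 0 := by decide
  obtain ⟨t₀, l₀, y₀, h₀⟩ := many (-i).val
  rw [zero] at h₀
  have rounds : ∀ j : ℕ, ∃ t' > t, Set.range (s t').pos =
      conf (y₀ + d + d * (j : ZMod n)) d (Gaps.perm m 0) := by
    intro j
    induction j with
    | zero =>
      obtain ⟨t₁, l₁, h₁⟩ := exists_round P hv hs hd h₀
      exact ⟨t₁, by omega, by simpa using h₁⟩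
    | succ j ih =>
      obtain ⟨t₁, l₁, h₁⟩ := ih
      obtain ⟨t₂, l₂, h₂⟩ := exists_round P hv hs hd h₁
      refine ⟨t₂, by omega, ?_⟩
      rw [h₂]
      congr 1
      push_cast; ring
  obtain ⟨t', l', h'⟩ := rounds (d * (x - (y₀ + d))).val
  refine ⟨t', l', ?_⟩
  rw [h', ZMod.natCast_zmod_val]
  have e : y₀ + d + d * (d * (x - (y₀ + d))) = x := by
    linear_combination (x - (y₀ + d)) * dir_mul_self hd
  rw [e]
  exact notMem_conf _ _ _

/-- Once in the cycle, a robot can only move by `-d`. The node it occupies becomes free later, so it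
has to move on, and `n` consecutive moves visit every node. -/
theorem visitsForever [NeZero n] (P : Params n k m) (hv : ∀ t, Valid m (s t))
    (hs : ∀ t, Step (algorithm n m) (s t) (s (t + 1))) : VisitsForever s := by
  obtain ⟨t₀, ht₀⟩ := exists_rank_eq_zero P hv hs
  obtain ⟨i₀, hi₀⟩ := exists_perm_of_rank P (hv t₀) (ht₀ t₀ le_rfl)
  obtain ⟨y₀, d, hd, h₀⟩ := exists_conf_of_photo_eq hi₀
  have regime : ∀ t ≥ t₀, ∃ y i, Set.range (s t).pos = conf y d (Gaps.perm m i) := by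
    intro t ht
    induction t, ht using Nat.le_induction with
    | base => exact ⟨y₀, i₀, h₀⟩
    | succ t _ ih =>
      obtain ⟨y, i, h⟩ := ih
      rcases (hv t).step_perm P (hs t) hd h with ⟨h1, -⟩ | ⟨-, h1⟩
      · exact ⟨y, i, by rw [h1, h]⟩
      · exact ⟨_, _, h1⟩
  have step : ∀ t ≥ t₀, ∀ r, (s (t + 1)).pos r = (s t).pos r ∨
      (s (t + 1)).pos r = (s t).pos r - d := by
    intro t ht r
    obtain ⟨y, i, h⟩ := regime t ht
    rcases (hv t).step_perm P (hs t) hd h with ⟨h1, -⟩ | ⟨h1, -⟩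
    · exact .inl (by rw [h1])
    · exact h1 r
  have move : ∀ t ≥ t₀, ∀ r, ∃ t' > t, (s t').pos r = (s t).pos r - d := by
    intro t ht r
    obtain ⟨y, i, h⟩ := regime t ht
    obtain ⟨t', ht', hx⟩ := exists_free P hv hs hd h ((s t).pos r)
    have first : ∀ u ≥ t, (∃ t' > t, (s t').pos r = (s t).pos r - d) ∨
        (s u).pos r = (s t).pos r := by
      intro u hu
      induction u, hu using Nat.le_induction with
      | base => exact .inr rfl
      | succ u hu ih =>
        rcases ih with ih | ih
        · exact .inl ih
        · rcases step u (by omega) r with h1 | h1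
          · exact .inr (h1.trans ih)
          · exact .inl ⟨u + 1, by omega, by rw [h1, ih]⟩
    rcases first t' (by omega) with h1 | h1
    · exact h1
    · exact absurd ⟨r, h1⟩ hx
  intro r x
  rw [frequently_atTop]
  intro a
  have turn : ∀ j : ℕ, ∃ t' ≥ max a t₀, (s t').pos r =
      (s (max a t₀)).pos r - d * (j : ZMod n) := by
    intro j
    induction j with
    | zero => exact ⟨_, le_rfl, by simp⟩
    | succ j ih =>
      obtain ⟨t₁, l₁, h₁⟩ := ih
      obtain ⟨t₂, l₂, h₂⟩ := move t₁ (le_trans (le_max_right _ _) l₁) r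
      refine ⟨t₂, by omega, ?_⟩
      rw [h₂, h₁]
      push_cast; ring
  obtain ⟨t', l', h'⟩ := turn (d * ((s (max a t₀)).pos r - x)).val
  refine ⟨t', le_trans (le_max_left _ _) l', ?_⟩
  rw [h', ZMod.natCast_zmod_val]
  linear_combination -((s (max a t₀)).pos r - x) * dir_mul_self hd

end
end RingRobots

theorem mainTheorem12 (n k : ℕ) (hk : k = n - 5) (hodd : Odd k) (hk3 : 3 < k) (hdvd : ¬ k ∣ n) :
    ∃ A : RingRobots.Algorithm n,
      (∀ i : Fin 5, A (RingRobots.permanentPhoto n i) =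
        some (RingRobots.permanentPhoto n (i + 1))) ∧
      ∀ init : Fin k → ZMod n, Function.Injective init →
        (Nat.Coprime n k ∨ RingRobots.Aperiodic init) →
        ∀ s : ℕ → RingRobots.State n k, RingRobots.IsExecution A init s →
          RingRobots.CollisionFree s ∧
          RingRobots.VisitsForever s ∧
          ∃ t₀ : ℕ, ∀ t ≥ t₀, ∃ i : Fin 5,
            RingRobots.photoAt (s t).pos = RingRobots.permanentPhoto n i := by
  -- `k = 5` would give `n = 10`, a multiple of `k`; so `k ≥ 7` and `m ≥ 4`.
  have h5 : k ≠ 5 := by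
    rintro rfl
    exact hdvd ⟨2, by omega⟩
  obtain ⟨q, hq⟩ := hodd
  have P : RingRobots.Params n k (k - 3) := ⟨by omega, by omega, by omega, by omega⟩
  have : NeZero n := ⟨by omega⟩
  refine ⟨RingRobots.algorithm n (k - 3), fun i => ?_, fun init hinj hper s hs => ?_⟩
  · rw [RingRobots.permanentPhoto_eq P, RingRobots.permanentPhoto_eq P,
      RingRobots.algorithm_perm P.four_le P.n_eq]
  · have hv := RingRobots.valid_execution P (.of_init P hinj hper) hs
    refine ⟨RingRobots.collisionFree P hv hs.step, RingRobots.visitsForever P hv hs.step, ?_⟩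
    obtain ⟨t₀, ht₀⟩ := RingRobots.exists_rank_eq_zero P hv hs.step
    refine ⟨t₀, fun t ht => ?_⟩
    obtain ⟨i, hi⟩ := RingRobots.exists_perm_of_rank P (hv t) (ht₀ t ht)
    exact ⟨i, by rw [hi, RingRobots.permanentPhoto_eq P]⟩
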